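/- **Setting.** $(X,d,\mu)$ and $(X',d',\mu')$ are metric spaces with Borel measures; $0<\mu(B)<\infty$ for all balls $B$ in $X$, and $\mu'$ is locally finite. Write $B(y,r)=\{z: d(z,y)<r\}$, $S(y,r)=\{z: d(z,y)=r\}$, $A(y,r_1,r_2)=\{z: r_1<d(z,y)<r_2\}$ (and likewise with $d'$). A domain is a nonempty open connected set; a continuum is a nonempty compact connected set. A path is a continuous map $\gamma:[a,b]\to X$, $a<b$, and $\Gamma(E,F,G)$ is the family of all paths with $\gamma(a)\in E$, $\gamma(b)\in F$ and $\gamma(t)\in G$ for $a<t<b$. For $p\ge 1$ the $p$-modulus $M_p(\Gamma)$ of a family of paths $\Gamma$ is $\inf_\rho\int\rho^p\,d\mu$ over all Borel functions $\rho\ge 0$ (with values in $[0,\infty]$) such that $\int_\gamma\rho\,ds\ge 1$ for all rectifiable $\gamma\in\Gamma$ (and $\infty$ if there is no such $\rho$). A metric measure space $Y$ is *$n$-Loewner* if it is pathwise connected and for every $t>0$ the infimum of $M_n(\Gamma(E,F,Y))$ over all disjoint nondegenerate continua $E,F\subset Y$ with $\operatorname{dist}(E,F)\le t\min\{\operatorname{diam}E,\operatorname{diam}F\}$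 is positive. A domain $D'\subset X'$ satisfies *condition A* if for any four different points $a,c\in D'$, $b,e\in\overline{D'}$ there are disjoint paths $\beta_1,\beta_2:[0,1]\to\overline{D'}$, joining $a$ to $b$ and $c$ to $e$ respectively, with $\beta_1(t),\beta_2(t)\in D'$ for $t\in[0,1)$. The space $X'$ is *upper $\alpha'$-regular* if for each $y\in X'$ there are $C,r_*>0$ with $\mu'(B(y,r))\le Cr^{\alpha'}$ for $0<r<r_*$. A measurable $Q:X'\to[0,\infty]$ is in $FMO(\overline{D'})$ if for every $y\in\overline{D'}$ it is integrable on some ball centred at $y$ and $$\limsup_{\varepsilon\to0}\frac1{\mu'(B(y,\varepsilon))}\int_{B(y,\varepsilon)}|Q-\overline Q_\varepsilon|\,d\mu'<\infty,\qquad \overline Q_\varepsilon=\frac1{\mu'(B(y,\varepsilon))}\int_{B(y,\varepsilon)}Q\,d\mu'$$ (averages over balls of measure zero are read as $0$). Let $D\subset X$ and $D'\subset X'$ be domains, $E\subset D$ a continuum, $\delta>0$, $\alpha,\alpha'\ge2$, and $Q:X'\to[0,\infty]$ measurable. Let $\mathfrak F^Q_{E,\delta}(D,D')$ be the family of all continuous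 open discrete maps $f:D\to D'$ with $\operatorname{diam}f(E)\ge\delta$ that satisfy the *inverse Poletsky inequality* at every $y\in X'$: for all $0<r_1<r_2<\sup_{w\in f(D)}d'(w,y)$ and every Borel function $\eta:(r_1,r_2)\to[0,\infty]$ with $\int_{r_1}^{r_2}\eta(r)\,dr\ge1$, $$M_\alpha(\Gamma_f(y,r_1,r_2))\le\int_{f(D)\cap A(y,r_1,r_2)}Q(w)\,\eta^{\alpha'}(d'(w,y))\,d\mu'(w),$$ where $\Gamma_f(y,r_1,r_2)$ is the family of all paths $\gamma$ in $D$ with $f\circ\gamma\in\Gamma(S(y,r_1),S(y,r_2),A(y,r_1,r_2))$. **Theorem 1.1.** Let $\alpha,\alpha'\ge 2$. Let $D$ be a domain in $X$ which, with the metric and measure of $X$, is a locally connected, locally compact $\alpha$-Loewner space of Hausdorff dimension $\alpha$. Let $D'$ be a domain in $X'$ that satisfies condition A, has at least two different boundary points and has compact closure. Let $X'$ be locally path connected, locally compact, of Hausdorff dimension $\alpha'$ and upper $\alpha'$-regular, and suppose that for each $z_0\in X'$ there are $c,r_*>0$ such that $$\mu'(B(z_0,2r))\le c\,\log^{\alpha'-2}\frac1r\;\mu'(B(z_0,r))\qquad\text{for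 all }r\in(0,r_*).$$ Let $Q\in FMO(\overline{D'})$, let $E\subset D$ be a continuum, $\delta>0$, and let $B(x_0,\varepsilon_1)\subset D$ for some $x_0\in D$, $\varepsilon_1>0$. Then there is $r_0>0$, not depending on $f$, such that $$f(B(x_0,\varepsilon_1))\supset B(f(x_0),r_0)\qquad\text{for all }f\in\mathfrak F^Q_{E,\delta}(D,D'),$$ where $B(f(x_0),r_0)$ is the ball in $X'$. -/

import Mathlib

open MeasureTheory Set Filter Topology
open scoped ENNReal NNReal

namespace MetricKoebe

/-- A path `γ : [left, right] → X`: a map continuous on a compact interval with `left < right`.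
The values of `toFun` outside `[left, right]` play no role. -/
structure Curve (X : Type*) [TopologicalSpace X] where
  left : ℝ
  right : ℝ
  left_lt_right : left < right
  toFun : ℝ → X
  continuousOn : ContinuousOn toFun (Icc left right)

/-- The image path `f ∘ γ` of a path under a continuous map. -/
def Curve.map {X Y : Type*} [TopologicalSpace X] [TopologicalSpace Y] (γ : Curve X) (f : C(X, Y)) :
    Curve Y where
  left := γ.left
  right := γ.right
  left_lt_right := γ.left_lt_right
  toFun := fun t => f (γ.toFun t)
  continuousOn := f.continuous.comp_continuousOn γ.continuousOn

/-- The length of a path: the supremum of the sums `∑ d (γ tᵢ) (γ tᵢ₋₁)` over all partitions. -/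
noncomputable def Curve.length {X : Type*} [PseudoEMetricSpace X] (γ : Curve X) : ℝ≥0∞ :=
  eVariationOn γ.toFun (Icc γ.left γ.right)

/-- A path is rectifiable if its length is finite. -/
def Curve.Rectifiable {X : Type*} [PseudoEMetricSpace X] (γ : Curve X) : Prop :=
  γ.length ≠ ∞

/-- The integral of `ρ` with respect to arc length along a rectifiable path: the integral of `ρ`
over `[0, length γ]` along the arc length parametrization of `γ`. -/
noncomputable def Curve.lineIntegral {X : Type*} [PseudoEMetricSpace X]
    (γ : Curve X) (ρ : X → ℝ≥0∞) : ℝ≥0∞ :=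
  ∫⁻ s in Icc (0 : ℝ) γ.length.toReal,
    ρ (naturalParameterization γ.toFun (Icc γ.left γ.right) γ.left s)

/-- `ρ` is admissible for the path family `Γ`. -/
def Admissible {X : Type*} [PseudoEMetricSpace X] [MeasurableSpace X]
    (Γ : Set (Curve X)) (ρ : X → ℝ≥0∞) : Prop :=
  Measurable ρ ∧ ∀ γ ∈ Γ, γ.Rectifiable → 1 ≤ γ.lineIntegral ρ

/-- The `p`-modulus of a path family; it is `∞` if there is no admissible function. -/
noncomputable def modulus {X : Type*} [PseudoEMetricSpace X] [MeasurableSpace X]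
    (μ : Measure X) (p : ℝ) (Γ : Set (Curve X)) : ℝ≥0∞ :=
  ⨅ (ρ : X → ℝ≥0∞) (_ : Admissible Γ ρ), ∫⁻ x, ρ x ^ p ∂μ

/-- The family `Γ(E, F, G)` of all paths that start in `E`, end in `F` and otherwise run in `G`. -/
def joining {X : Type*} [TopologicalSpace X] (E F G : Set X) : Set (Curve X) :=
  {γ | γ.toFun γ.left ∈ E ∧ γ.toFun γ.right ∈ F ∧ ∀ t ∈ Ioo γ.left γ.right, γ.toFun t ∈ G}

/-- The open spherical ring `A(y, r₁, r₂)`. -/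
def ring {X : Type*} [PseudoMetricSpace X] (y : X) (r₁ r₂ : ℝ) : Set X :=
  {z | r₁ < dist z y ∧ dist z y < r₂}

/-- The distance between two (nonempty) sets. -/
noncomputable def setDist {X : Type*} [PseudoMetricSpace X] (E F : Set X) : ℝ :=
  sInf {r | ∃ x ∈ E, ∃ y ∈ F, r = dist x y}

/-- A continuum: a nonempty compact connected set. -/
def IsContinuum {X : Type*} [TopologicalSpace X] (E : Set X) : Prop :=
  IsCompact E ∧ IsConnected E

/-- The relative distance `Δ(E, F)` of two nondegenerate continua. -/
noncomputable def relDist {X : Type*} [PseudoMetricSpace X] (E F : Set X) : ℝ :=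
  setDist E F / min (Metric.diam E) (Metric.diam F)

/-- The Loewner function: the infimum of the `n`-moduli of `Γ(E, F, X)` over all disjoint
nondegenerate continua `E`, `F` in `X` with `Δ(E, F) ≤ t`. -/
noncomputable def loewnerFunction {X : Type*} [PseudoMetricSpace X] [MeasurableSpace X]
    (μ : Measure X) (n t : ℝ) : ℝ≥0∞ :=
  ⨅ (E : Set X) (F : Set X) (_ : IsContinuum E ∧ E.Nontrivial ∧ IsContinuum F ∧ F.Nontrivial ∧
    Disjoint E F ∧ relDist E F ≤ t), modulus μ n (joining E F univ)

/-- An `n`-Loewner space: pathwise connected, with a positive Loewner function. -/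
def IsLoewnerSpace {X : Type*} [PseudoMetricSpace X] [MeasurableSpace X]
    (μ : Measure X) (n : ℝ) : Prop :=
  PathConnectedSpace X ∧ ∀ t : ℝ, 0 < t → 0 < loewnerFunction μ n t

/-- A domain: a nonempty open connected set. -/
def IsMetricDomain {X : Type*} [TopologicalSpace X] (D : Set X) : Prop :=
  IsOpen D ∧ IsConnected D

/-- Upper `a`-regularity (at every point, with constants that may depend on the point). -/
def UpperRegular {X : Type*} [PseudoMetricSpace X] [MeasurableSpace X]
    (μ : Measure X) (a : ℝ) : Prop :=
  ∀ x : X, ∃ C > (0 : ℝ), ∃ r₀ > (0 : ℝ), ∀ r : ℝ, 0 < r → r < r₀ →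
    μ (Metric.ball x r) ≤ ENNReal.ofReal (C * r ^ a)

/-- The logarithmic doubling condition
`μ (B(z, 2r)) ≤ c * (log (1 / r)) ^ (a - 2) * μ (B(z, r))` for all small `r`, at every `z`. -/
def LogDoubling {X : Type*} [PseudoMetricSpace X] [MeasurableSpace X]
    (μ : Measure X) (a : ℝ) : Prop :=
  ∀ z : X, ∃ c > (0 : ℝ), ∃ r₀ > (0 : ℝ), ∀ r : ℝ, 0 < r → r < r₀ →
    μ (Metric.ball z (2 * r)) ≤
      ENNReal.ofReal (c * Real.log (1 / r) ^ (a - 2)) * μ (Metric.ball z r)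

/-- Finite mean oscillation at `y` of a measurable function with values in `[0, ∞]`: it is
integrable on some ball around `y` (so finite almost everywhere there), and its mean oscillations
over the balls `B(y, ε)` have a finite upper limit as `ε → 0`. -/
def HasFMOAt {X : Type*} [PseudoMetricSpace X] [MeasurableSpace X]
    (μ : Measure X) (Q : X → ℝ≥0∞) (y : X) : Prop :=
  (∃ r > (0 : ℝ), ∫⁻ z in Metric.ball y r, Q z ∂μ ≠ ∞) ∧
  limsup (fun ε : ℝ => ENNReal.ofReal (⨍ z in Metric.ball y ε,
    |(Q z).toReal - ⨍ w in Metric.ball y ε, (Q w).toReal ∂μ| ∂μ)) (𝓝[>] 0) < ∞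

/-- Condition **A**: any pairs `a ∈ D`, `b ∈ closure D` and `c ∈ D`, `d ∈ closure D` (four different
points) can be joined by disjoint paths that stay in `D` except possibly for the last point. -/
def ConditionA {X : Type*} [TopologicalSpace X] (D : Set X) : Prop :=
  ∀ a b c d : X, a ∈ D → b ∈ closure D → c ∈ D → d ∈ closure D →
    a ≠ b → a ≠ c → a ≠ d → b ≠ c → b ≠ d → c ≠ d →
    ∃ (p : Path a b) (q : Path c d), (∀ t, t < 1 → p t ∈ D) ∧ (∀ t, t < 1 → q t ∈ D) ∧
      Disjoint (range p) (range q)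

/-- The family `Γ_f(y, r₁, r₂)` of all paths in the source whose images start on `S(y, r₁)`, end on
`S(y, r₂)` and otherwise run in the ring `A(y, r₁, r₂)`. -/
def ringFamily {X Y : Type*} [TopologicalSpace X] [PseudoMetricSpace Y] (f : C(X, Y))
    (y : Y) (r₁ r₂ : ℝ) : Set (Curve X) :=
  {γ | γ.map f ∈ joining (Metric.sphere y r₁) (Metric.sphere y r₂) (ring y r₁ r₂)}

/-- The inverse Poletsky inequality for `f` at `y`, with exponents `a`, `a'` and weight `Q`, for all
`0 < r₁ < r₂ < sup_{w ∈ f(X)} d(w, y)`. The test functions `η` are Borel, so that the integrand on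
the right is measurable. -/
def InversePoletskyAt {X Y : Type*} [PseudoMetricSpace X] [MeasurableSpace X]
    [PseudoMetricSpace Y] [MeasurableSpace Y] (μ : Measure X) (ν : Measure Y) (a a' : ℝ)
    (Q : Y → ℝ≥0∞) (f : C(X, Y)) (y : Y) : Prop :=
  ∀ r₁ r₂ : ℝ, 0 < r₁ → r₁ < r₂ → (∃ x : X, r₂ < dist (f x) y) →
    ∀ η : ℝ → ℝ≥0∞, Measurable η → 1 ≤ ∫⁻ r in Ioo r₁ r₂, η r →
      modulus μ a (ringFamily f y r₁ r₂) ≤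
        ∫⁻ w in range f ∩ ring y r₁ r₂, Q w * η (dist w y) ^ a' ∂ν

/-- The class of all open discrete maps `f : D → D'` that satisfy the inverse Poletsky inequality
at every point of the target space and for which `f(E)` has diameter at least `δ`. The domain `D`
carries the metric and the measure of the space around it. -/
def koebeClass {X Y : Type*} [MetricSpace X] [MeasurableSpace X]
    [MetricSpace Y] [MeasurableSpace Y] (μ : Measure X) (ν : Measure Y) (a a' : ℝ)
    (D : Set X) (D' : Set Y) (Q : Y → ℝ≥0∞) (E : Set D) (δ : ℝ) : Set C(D, Y) :=
  {f | (∀ x, f x ∈ D') ∧ IsOpenMap f ∧ (∀ y, DiscreteTopology (f ⁻¹' {y})) ∧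
    (∀ y : Y, InversePoletskyAt (μ.comap ((↑) : D → X)) ν a a' Q f y) ∧
    δ ≤ Metric.diam (f '' E)}

end MetricKoebe

namespace MetricKoebe

/-! Suppose `y` is close to `f x₀` but omitted by the image of the ball. Join `f x₀` to `y` by a
short path and lift it: since `f` is open, the component `C` of the preimage through `x₀` cannot
stop inside the ball, so it reaches a sphere `S(x₀, R)` (`exists_continuum_or_subset_image`). Since
`f(E)` is large and the family is equicontinuous, `E` contains a continuum `P` of diameter bounded
below whose image stays away from `f x₀`. The Loewner property bounds the modulus of the paths
joining `C` to `P` from below, while the inverse Poletsky inequality makes it as small as desired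
once the path is short enough. This is a contradiction, and compactness of the closure of `D'` makes
the radius uniform.

Smallness comes from finite mean oscillation. By logarithmic doubling the means of `Q` over dyadic
balls grow at most like `k ^ (α' - 1)`, and a test function of size about `2 ^ k / k` on the `k`-th
dyadic ring, normalized by a partial harmonic sum, has energy tending to zero
(`exists_test_function`).

Equicontinuity is again a modulus argument. If close points had images far apart, condition A would
put these images in disjoint continua leaving `D'`; their lifts are continua of definite size that
come close together. Inverse Poletsky with a constant test function bounds the modulus between the
lifts, by integrability of `Q`. But this modulus must blow up: points have zero capacity, so the
Loewner bound can be used independently at arbitrarily many scales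
(`HasZeroCapacity.exists_lt_modulus`). Zero capacity is itself read off from any one discrete map of
the class (`hasZeroCapacity_of_ringFamily`). -/

theorem continuousOn_variationOnFromTo {E : Type*} [PseudoMetricSpace E] {f : ℝ → E} {s : Set ℝ}
    {a : ℝ} (ha : a ∈ s) (hf : LocallyBoundedVariationOn f s) (hc : ContinuousOn f s) :
    ContinuousOn (variationOnFromTo f s a) s := by
  intro b hb
  have hl : ContinuousWithinAt (variationOnFromTo f s a) (s ∩ Iio b) b := by
    have := variationOnFromTo.tendsto_left ha hb hf ((hc b hb).mono inter_subset_left)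
    simpa [ContinuousWithinAt] using this
  have hr : ContinuousWithinAt (variationOnFromTo f s a) (s ∩ Ioi b) b := by
    have := variationOnFromTo.tendsto_right ha hb hf ((hc b hb).mono inter_subset_left)
    simpa [ContinuousWithinAt] using this
  refine ((hl.union hr).union (continuousWithinAt_singleton (x := b))).mono fun t ht => ?_
  rcases lt_trichotomy t b with h | h | h
  · exact Or.inl (Or.inl ⟨ht, h⟩)
  · exact Or.inr h
  · exact Or.inl (Or.inr ⟨ht, h⟩)

/-- The restriction of a path to a nondegenerate subinterval. -/
def Curve.restrict {X : Type*} [TopologicalSpace X] (γ : Curve X) (a b : ℝ) (hab : a < b)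
    (ha : γ.left ≤ a) (hb : b ≤ γ.right) : Curve X where
  left := a
  right := b
  left_lt_right := hab
  toFun := γ.toFun
  continuousOn := γ.continuousOn.mono (Icc_subset_Icc ha hb)

/-! ### Arc length, subpaths and crossings. -/

section Curves

variable {X : Type*} [MetricSpace X] {γ : Curve X}

theorem Curve.left_mem (γ : Curve X) : γ.left ∈ Icc γ.left γ.right :=
  left_mem_Icc.2 γ.left_lt_right.le

theorem Curve.right_mem (γ : Curve X) : γ.right ∈ Icc γ.left γ.right :=
  right_mem_Icc.2 γ.left_lt_right.le

theorem Curve.Rectifiable.locallyBoundedVariationOn (h : γ.Rectifiable) :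
    LocallyBoundedVariationOn γ.toFun (Icc γ.left γ.right) :=
  BoundedVariationOn.locallyBoundedVariationOn h

theorem Curve.Rectifiable.naturalParameterization_variation (h : γ.Rectifiable) {t : ℝ}
    (ht : t ∈ Icc γ.left γ.right) :
    naturalParameterization γ.toFun (Icc γ.left γ.right) γ.left
      (variationOnFromTo γ.toFun (Icc γ.left γ.right) γ.left t) = γ.toFun t :=
  edist_eq_zero.1 (edist_naturalParameterization_eq_zero h.locallyBoundedVariationOn γ.left_mem ht)

theorem Curve.variation_right (γ : Curve X) :
    variationOnFromTo γ.toFun (Icc γ.left γ.right) γ.left γ.right = γ.length.toReal := by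
  rw [variationOnFromTo.eq_of_le _ _ γ.left_lt_right.le, inter_self, Curve.length]

/-- Arc length is continuous along a continuous path, so it omits no value. Hence the natural
parametrization, defined by choice, takes genuine values of `γ` on all of `[0, length γ]`. -/
theorem Curve.Rectifiable.exists_variation_eq (h : γ.Rectifiable) {s : ℝ}
    (hs : s ∈ Icc 0 γ.length.toReal) : ∃ t ∈ Icc γ.left γ.right,
      variationOnFromTo γ.toFun (Icc γ.left γ.right) γ.left t = s := by
  have hc := continuousOn_variationOnFromTo γ.left_mem h.locallyBoundedVariationOn γ.continuousOn
  have := intermediate_value_Icc γ.left_lt_right.le hc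
  rw [variationOnFromTo.self, γ.variation_right] at this
  exact this hs

theorem Curve.Rectifiable.naturalParameterization_mem (h : γ.Rectifiable) {s : ℝ}
    (hs : s ∈ Icc 0 γ.length.toReal) :
    naturalParameterization γ.toFun (Icc γ.left γ.right) γ.left s ∈
      γ.toFun '' Icc γ.left γ.right := by
  obtain ⟨t, ht, rfl⟩ := h.exists_variation_eq hs
  exact ⟨t, ht, (h.naturalParameterization_variation ht).symm⟩

theorem Curve.Rectifiable.restrict (h : γ.Rectifiable) {a b : ℝ} (hab : a < b)
    (ha : γ.left ≤ a) (hb : b ≤ γ.right) : (γ.restrict a b hab ha hb).Rectifiable :=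
  ne_top_of_le_ne_top h (eVariationOn.mono _ (Icc_subset_Icc ha hb))

/-- The arc length parametrization of the subpath is that of `γ` shifted by the length `v a` already
covered, and Lebesgue measure is translation invariant. -/
theorem Curve.Rectifiable.lineIntegral_restrict_le (h : γ.Rectifiable) {a b : ℝ} (hab : a < b)
    (ha : γ.left ≤ a) (hb : b ≤ γ.right) (ρ : X → ℝ≥0∞) :
    (γ.restrict a b hab ha hb).lineIntegral ρ ≤ γ.lineIntegral ρ := by
  set γ' := γ.restrict a b hab ha hb with hγ'
  have h' : γ'.Rectifiable := h.restrict hab ha hb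
  set v := variationOnFromTo γ.toFun (Icc γ.left γ.right) γ.left with hv
  set g := naturalParameterization γ.toFun (Icc γ.left γ.right) γ.left with hg
  have hmem : ∀ t ∈ Icc a b, t ∈ Icc γ.left γ.right := fun t ht => Icc_subset_Icc ha hb ht
  have haa : a ∈ Icc γ.left γ.right := hmem a ⟨le_rfl, hab.le⟩
  have hv' : ∀ t ∈ Icc a b, variationOnFromTo γ.toFun (Icc a b) a t + v a = v t := by
    intro t ht
    rw [hv, ← variationOnFromTo.add h.locallyBoundedVariationOn γ.left_mem haa (hmem t ht),
      add_comm, variationOnFromTo.eq_of_le _ _ ht.1, variationOnFromTo.eq_of_le _ _ ht.1]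
    congr 3
    rw [inter_eq_self_of_subset_right (Icc_subset_Icc le_rfl ht.2),
      inter_eq_self_of_subset_right (Icc_subset_Icc ha (ht.2.trans hb))]
  have hL : γ'.length.toReal + v a = v b := by
    rw [← γ'.variation_right]
    exact hv' b ⟨hab.le, le_rfl⟩
  have hmono := variationOnFromTo.monotoneOn h.locallyBoundedVariationOn γ.left_mem
  have h0 : 0 ≤ v a := variationOnFromTo.nonneg_of_le _ _ ha
  have h1 : v b ≤ γ.length.toReal := by
    rw [← γ.variation_right]
    exact hmono (hmem b ⟨hab.le, le_rfl⟩) γ.right_mem hb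
  have hpre : (fun s => s + v a) ⁻¹' Icc (v a) (v b) = Icc 0 γ'.length.toReal := by
    ext s
    simp only [mem_preimage, mem_Icc, ← hL]
    constructor <;> rintro ⟨h2, h3⟩ <;> constructor <;> linarith
  calc γ'.lineIntegral ρ = ∫⁻ s in Icc 0 γ'.length.toReal, ρ (g (s + v a)) := by
        refine setLIntegral_congr_fun measurableSet_Icc fun s hs => ?_
        obtain ⟨t, ht, rfl⟩ := h'.exists_variation_eq hs
        have h3 := h'.naturalParameterization_variation ht
        simp only [h3]
        have h4 : variationOnFromTo γ'.toFun (Icc γ'.left γ'.right) γ'.left t + v a = v t := hv' t ht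
        rw [h4, hg, h.naturalParameterization_variation (hmem t ht)]
        rfl
    _ = ∫⁻ s in Icc (v a) (v b), ρ (g s) := by
        rw [← hpre]
        exact (measurePreserving_add_right volume (v a)).setLIntegral_comp_preimage_emb
          (measurableEmbedding_addRight (v a)) (fun s => ρ (g s)) _
    _ ≤ γ.lineIntegral ρ := lintegral_mono_set (Icc_subset_Icc h0 h1)

/-- A continuous real function on `[a, b]` that rises from `≤ r₁` to `≥ r₂` crosses the interval
`(r₁, r₂)` on some subinterval. -/
theorem exists_crossing {h : ℝ → ℝ} {a b r₁ r₂ : ℝ} (hab : a ≤ b) (hc : ContinuousOn h (Icc a b))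
    (hr : r₁ < r₂) (ha : h a ≤ r₁) (hb : r₂ ≤ h b) :
    ∃ s t, a ≤ s ∧ s < t ∧ t ≤ b ∧ h s = r₁ ∧ h t = r₂ ∧ ∀ u ∈ Ioo s t, r₁ < h u ∧ h u < r₂ := by
  have hK : IsCompact (Icc a b ∩ h ⁻¹' Ici r₂) :=
    isCompact_Icc.of_isClosed_subset (hc.preimage_isClosed_of_isClosed isClosed_Icc isClosed_Ici)
      inter_subset_left
  obtain ⟨t, ⟨ht, htr⟩, htmin⟩ := hK.exists_isLeast ⟨b, ⟨hab, le_rfl⟩, hb⟩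
  have hc' : ContinuousOn h (Icc a t) := hc.mono (Icc_subset_Icc le_rfl ht.2)
  have hK' : IsCompact (Icc a t ∩ h ⁻¹' Iic r₁) :=
    isCompact_Icc.of_isClosed_subset (hc'.preimage_isClosed_of_isClosed isClosed_Icc isClosed_Iic)
      inter_subset_left
  obtain ⟨s, ⟨hs, hsr⟩, hsmax⟩ := hK'.exists_isGreatest ⟨a, ⟨le_rfl, ht.1⟩, ha⟩
  simp only [mem_preimage, mem_Ici, mem_Iic] at htr hsr
  have hst : s < t := lt_of_le_of_ne hs.2 (by rintro rfl; linarith)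
  have hlt : ∀ u ∈ Ico a t, h u < r₂ := fun u hu => by
    by_contra! hcon
    exact (htmin ⟨⟨hu.1, hu.2.le.trans ht.2⟩, hcon⟩).not_gt hu.2
  have hgt : ∀ u ∈ Ioc s t, r₁ < h u := fun u hu => by
    by_contra! hcon
    exact (hsmax ⟨⟨hs.1.trans hu.1.le, hu.2⟩, hcon⟩).not_gt hu.1
  have hcs : ContinuousOn h (Icc s t) := hc'.mono (Icc_subset_Icc hs.1 le_rfl)
  refine ⟨s, t, hs.1, hst, ht.2, ?_, ?_, fun u hu => ⟨hgt u ⟨hu.1, hu.2.le⟩,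
    hlt u ⟨hs.1.trans hu.1.le, hu.2⟩⟩⟩
  · obtain ⟨u, hu, hur⟩ := intermediate_value_Icc hst.le hcs ⟨hsr, hr.le.trans htr⟩
    rcases hu.1.eq_or_lt with rfl | h'
    · exact hur
    · exact absurd hur (hgt u ⟨h', hu.2⟩).ne'
  · obtain ⟨u, hu, hur⟩ := intermediate_value_Icc hst.le hcs ⟨hsr.trans hr.le, htr⟩
    rcases hu.2.eq_or_lt with rfl | h'
    · exact hur
    · exact absurd hur (hlt u ⟨hs.1.trans hu.1, h'⟩).ne

/-- `γ'` is a subpath of `γ`. -/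
def Curve.IsSub (γ' γ : Curve X) : Prop :=
  ∃ a b, ∃ (hab : a < b) (ha : γ.left ≤ a) (hb : b ≤ γ.right), γ' = γ.restrict a b hab ha hb

theorem Curve.isSub_refl (γ : Curve X) : γ.IsSub γ :=
  ⟨γ.left, γ.right, γ.left_lt_right, le_rfl, le_rfl, rfl⟩

end Curves

/-! ### Monotonicity and subadditivity of the modulus. -/

section Modulus

variable {X : Type*} [MetricSpace X] [MeasurableSpace X] {μ : Measure X} {p : ℝ}

/-- Line integrals only grow when a path is prolonged, so a function admissible for the subpaths is
admissible for `Γ`. -/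
theorem modulus_le_of_minorized {Γ Γ' : Set (Curve X)} (h : ∀ γ ∈ Γ, ∃ γ' ∈ Γ', γ'.IsSub γ) :
    modulus μ p Γ ≤ modulus μ p Γ' := by
  refine le_iInf₂ fun ρ hρ => iInf₂_le ρ ⟨hρ.1, fun γ hγ hr => ?_⟩
  obtain ⟨_, hγ', a, b, hab, ha, hb, rfl⟩ := h γ hγ
  exact (hρ.2 _ hγ' (hr.restrict hab ha hb)).trans (hr.lineIntegral_restrict_le hab ha hb ρ)

theorem modulus_mono {Γ Γ' : Set (Curve X)} (h : Γ ⊆ Γ') : modulus μ p Γ ≤ modulus μ p Γ' :=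
  modulus_le_of_minorized fun γ hγ => ⟨γ, h hγ, γ.isSub_refl⟩

theorem modulus_empty (hp : 0 < p) : modulus μ p ∅ = 0 := by
  refine le_antisymm ((iInf₂_le (fun _ => 0) ⟨measurable_const, by simp⟩).trans ?_) zero_le
  simp [ENNReal.zero_rpow_of_pos hp]

/-- The maximum of two admissible functions is admissible for the union, and its `p`-th power is at
most the sum of theirs. -/
theorem modulus_union_le (Γ Γ' : Set (Curve X)) :
    modulus μ p (Γ ∪ Γ') ≤ modulus μ p Γ + modulus μ p Γ' := by
  simp only [modulus, ENNReal.iInf_add, ENNReal.add_iInf]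
  refine le_iInf₂ fun ρ' hρ' => le_iInf₂ fun ρ hρ => ?_
  have hadm : Admissible (Γ ∪ Γ') (fun x => max (ρ x) (ρ' x)) := by
    refine ⟨hρ.1.max hρ'.1, ?_⟩
    rintro γ (hγ | hγ) hr
    · exact (hρ.2 γ hγ hr).trans (lintegral_mono fun s => le_max_left _ _)
    · exact (hρ'.2 γ hγ hr).trans (lintegral_mono fun s => le_max_right _ _)
  refine (iInf₂_le _ hadm).trans ?_
  rw [← lintegral_add_left (hρ.1.pow_const p)]
  refine lintegral_mono fun x => ?_
  rcases max_choice (ρ x) (ρ' x) with h | h <;> simp only [h]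
  · exact le_self_add
  · exact le_add_self

theorem modulus_biUnion_le {ι : Type*} (hp : 0 < p) (s : Finset ι) (Γ : ι → Set (Curve X)) :
    modulus μ p (⋃ i ∈ s, Γ i) ≤ ∑ i ∈ s, modulus μ p (Γ i) := by
  classical
  induction s using Finset.induction_on with
  | empty => simp [modulus_empty hp]
  | insert i s his ih =>
    rw [Finset.set_biUnion_insert, Finset.sum_insert his]
    exact (modulus_union_le _ _).trans (by gcongr)

/-- If `ρ` is admissible for `Γ`, then its energy on `A` bounds the modulus of the paths of `Γ` that
run in `A`. -/
theorem modulus_le_setLIntegral (hp : 0 < p) {Γ Γ' : Set (Curve X)} {A : Set X}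
    (hA : MeasurableSet A) {ρ : X → ℝ≥0∞} (hρ : Admissible Γ ρ) (hΓ : Γ' ⊆ Γ)
    (hΓA : ∀ γ ∈ Γ', ∀ t ∈ Icc γ.left γ.right, γ.toFun t ∈ A) :
    modulus μ p Γ' ≤ ∫⁻ x in A, ρ x ^ p ∂μ := by
  have hadm : Admissible Γ' (A.indicator ρ) := by
    refine ⟨hρ.1.indicator hA, fun γ hγ hr => ?_⟩
    refine (hρ.2 γ (hΓ hγ) hr).trans (le_of_eq ?_)
    refine setLIntegral_congr_fun measurableSet_Icc fun s hs => ?_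
    obtain ⟨t, ht, hts⟩ := hr.naturalParameterization_mem hs
    simp only [← hts, indicator_of_mem (hΓA γ hγ t ht)]
  refine (iInf₂_le _ hadm).trans ?_
  rw [← lintegral_indicator hA]
  refine lintegral_mono fun x => ?_
  by_cases hx : x ∈ A
  · simp [hx]
  · simp [hx, ENNReal.zero_rpow_of_pos hp]

end Modulus

/-! ### Subcontinua, lifting of continua and the Loewner bound. -/

section Continua

/-- In a compact set, the component of a point can be separated by a clopen subset from a closed set
that it does not meet. -/
theorem exists_clopen_of_disjoint_connectedComponentIn {X : Type*} [TopologicalSpace X] [T2Space X]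
    {K A : Set X} (hK : IsCompact K) {x : X} (hx : x ∈ K) (hA : IsClosed A)
    (hd : Disjoint (connectedComponentIn K x) A) :
    ∃ W, IsOpen W ∧ x ∈ W ∧ IsCompact (K ∩ W) ∧ Disjoint (K ∩ W) A := by
  have : CompactSpace K := isCompact_iff_compactSpace.1 hK
  let x' : K := ⟨x, hx⟩
  -- In a compact Hausdorff space components are intersections of clopen sets; by compactness one of
  -- these already misses `A`.
  have hsub : ⋂ s : { s : Set K // IsClopen s ∧ x' ∈ s }, (s : Set K) ⊆ ((↑) ⁻¹' A)ᶜ := by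
    rw [← connectedComponent_eq_iInter_isClopen]
    intro z hz hzA
    refine disjoint_left.1 hd ?_ hzA
    rw [connectedComponentIn_eq_image hx]
    exact ⟨z, hz, rfl⟩
  have : Nonempty { s : Set K // IsClopen s ∧ x' ∈ s } := ⟨⟨univ, isClopen_univ, mem_univ _⟩⟩
  obtain ⟨⟨Z, hZ, hxZ⟩, hZA⟩ := exists_subset_nhds_of_compactSpace
    (V := fun s : { s : Set K // IsClopen s ∧ x' ∈ s } => (s : Set K))
    (U := ((↑) ⁻¹' A)ᶜ)
    (fun s t => ⟨⟨s ∩ t, s.2.1.inter t.2.1, s.2.2, t.2.2⟩, inter_subset_left, inter_subset_right⟩)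
    (fun s => s.2.1.1)
    (fun z hz => ((hA.preimage continuous_subtype_val).isOpen_compl).mem_nhds (hsub hz))
  obtain ⟨W, hW, rfl⟩ := isOpen_induced_iff.1 hZ.2
  have himg : K ∩ W = (↑) '' ((↑) ⁻¹' W : Set K) := by
    rw [Subtype.image_preimage_coe]
  refine ⟨W, hW, hxZ, ?_, ?_⟩
  · rw [himg]
    exact hZ.1.isCompact.image continuous_subtype_val
  · rw [himg, disjoint_left]
    rintro _ ⟨z, hz, rfl⟩ hzA
    exact hZA hz hzA

theorem isContinuum_connectedComponentIn {X : Type*} [TopologicalSpace X] [T2Space X]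
    {K : Set X} (hK : IsCompact K) {x : X} (hx : x ∈ K) :
    IsContinuum (connectedComponentIn K x) := by
  have : CompactSpace K := isCompact_iff_compactSpace.1 hK
  refine ⟨?_, isConnected_connectedComponentIn_iff.2 hx⟩
  rw [connectedComponentIn_eq_image hx]
  exact isClosed_connectedComponent.isCompact.image continuous_subtype_val

variable {X Y : Type*} [MetricSpace X]

/-- A continuum that leaves the ball `B(c, r)` around one of its points `c` contains a continuum in
the closed ball that joins `c` to the sphere. -/
theorem IsContinuum.exists_subcontinuum {C : Set X} (hC : IsContinuum C) {c : X} (hc : c ∈ C)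
    {r : ℝ} (hr : 0 < r) (hout : ∃ z ∈ C, r ≤ dist z c) :
    ∃ P ⊆ C ∩ Metric.closedBall c r, IsContinuum P ∧ c ∈ P ∧ ∃ z ∈ P, dist z c = r := by
  set K := C ∩ Metric.closedBall c r with hKdef
  have hK : IsCompact K := hC.1.inter_right Metric.isClosed_closedBall
  have hcK : c ∈ K := ⟨hc, Metric.mem_closedBall_self hr.le⟩
  refine ⟨connectedComponentIn K c, connectedComponentIn_subset _ _,
    isContinuum_connectedComponentIn hK hcK, mem_connectedComponentIn hcK, ?_⟩
  by_contra! hcon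
  have hA : IsClosed {z | r ≤ dist z c} := isClosed_le continuous_const (by fun_prop)
  obtain ⟨W, hW, hcW, hKW, hdis⟩ := exists_clopen_of_disjoint_connectedComponentIn hK hcK hA
    (disjoint_left.2 fun z hz hzA => hcon z hz
      (le_antisymm (connectedComponentIn_subset _ _ hz).2 hzA))
  obtain ⟨z, hzC, hzr⟩ := hout
  have h1 : C ∩ (W ∩ Metric.ball c r) ⊆ K ∩ W := fun w hw =>
    ⟨⟨hw.1, Metric.ball_subset_closedBall hw.2.2⟩, hw.2.1⟩
  have h2 : K ∩ W ⊆ W ∩ Metric.ball c r := fun w hw => ⟨hw.2, by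
    have := disjoint_left.1 hdis hw
    simpa using this⟩
  -- By `h1` and `h2`, `K ∩ W` is the trace on `C` of the open set `W ∩ ball c r`. It would be
  -- relatively clopen in `C`, containing `c` but not `z`.
  obtain ⟨w, hwC, hw1, hw2⟩ := hC.2.isPreconnected (W ∩ Metric.ball c r) (K ∩ W)ᶜ
    (hW.inter Metric.isOpen_ball) hKW.isClosed.isOpen_compl
    (fun w hw => (em (w ∈ K ∩ W)).imp (fun h => h2 h) id)
    ⟨c, hc, hcW, Metric.mem_ball_self hr⟩
    ⟨z, hzC, fun hz => disjoint_left.1 hdis hz hzr⟩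
  exact hw2 (h1 ⟨hwC, hw1⟩)

/-- Components of preimages under an open map: either the component at `x` of the preimage of a
connected closed set `β` reaches the sphere `S(x₀, r)`, or the ball `B(x₀, r)` covers `β`. -/
theorem exists_continuum_or_subset_image [TopologicalSpace Y] [T2Space Y] (f : C(X, Y))
    (hf : IsOpenMap f) {x₀ x : X} {r : ℝ} (hcomp : IsCompact (Metric.closedBall x₀ r))
    (hx : x ∈ Metric.ball x₀ r) {β : Set Y} (hβ : IsClosed β) (hβc : IsPreconnected β)
    (hxβ : f x ∈ β) :
    (∃ C ⊆ Metric.closedBall x₀ r, IsContinuum C ∧ x ∈ C ∧ f '' C ⊆ β ∧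
      ∃ z ∈ C, dist z x₀ = r) ∨ β ⊆ f '' Metric.ball x₀ r := by
  set K := f ⁻¹' β ∩ Metric.closedBall x₀ r with hKdef
  have hK : IsCompact K := hcomp.inter_left (hβ.preimage f.continuous)
  have hxK : x ∈ K := ⟨hxβ, Metric.ball_subset_closedBall hx⟩
  by_cases hcase : ∃ z ∈ connectedComponentIn K x, dist z x₀ = r
  · exact Or.inl ⟨_, (connectedComponentIn_subset _ _).trans inter_subset_right,
      isContinuum_connectedComponentIn hK hxK, mem_connectedComponentIn hxK,
      image_subset_iff.2 ((connectedComponentIn_subset _ _).trans inter_subset_left), hcase⟩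
  right
  push Not at hcase
  have hA : IsClosed {z | r ≤ dist z x₀} := isClosed_le continuous_const (by fun_prop)
  obtain ⟨W, hW, hxW, hKW, hdis⟩ := exists_clopen_of_disjoint_connectedComponentIn hK hxK hA
    (disjoint_left.2 fun z hz hzA => hcase z hz
      (le_antisymm (connectedComponentIn_subset _ _ hz).2 hzA))
  have h2 : K ∩ W ⊆ W ∩ Metric.ball x₀ r := fun w hw => ⟨hw.2, by
    have := disjoint_left.1 hdis hw
    simpa using this⟩
  have hcl : IsClosed (f '' (K ∩ W)) := (hKW.image f.continuous).isClosed
  by_contra hnot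
  obtain ⟨b, hb, hbn⟩ := not_subset.1 hnot
  -- On `β`, the open image of `W ∩ ball x₀ r` and the compact image of `K ∩ W` coincide. So this
  -- trace is clopen in `β`, and connectedness makes it all of `β`.
  obtain ⟨w, hwβ, ⟨u, hu, rfl⟩, hw2⟩ := hβc (f '' (W ∩ Metric.ball x₀ r)) (f '' (K ∩ W))ᶜ
    (hf _ (hW.inter Metric.isOpen_ball)) hcl.isOpen_compl
    (fun w hw => (em (w ∈ f '' (K ∩ W))).imp (fun h => image_mono h2 h) id)
    ⟨f x, hxβ, mem_image_of_mem f ⟨hxW, hx⟩⟩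
    ⟨b, hb, fun h => hbn (image_mono (h2.trans inter_subset_right) h)⟩
  exact hw2 ⟨u, ⟨⟨hwβ, Metric.ball_subset_closedBall hu.2⟩, hu.1⟩, rfl⟩

theorem setDist_le {E F : Set X} {x y : X} (hx : x ∈ E) (hy : y ∈ F) : setDist E F ≤ dist x y :=
  csInf_le ⟨0, by rintro _ ⟨_, _, _, _, rfl⟩; exact dist_nonneg⟩ ⟨x, hx, y, hy, rfl⟩

/-- The Loewner lower bound for continua with a bounded distance and diameters bounded below. -/
theorem loewnerFunction_le_modulus [MeasurableSpace X] {μ : Measure X} {n : ℝ} {E F : Set X}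
    (hE : IsContinuum E) (hF : IsContinuum F) (hd : Disjoint E F) {x x' y y' : X} {c T : ℝ}
    (hc : 0 < c) (hT : 0 ≤ T) (hx : x ∈ E) (hx' : x' ∈ E) (hy : y ∈ F) (hy' : y' ∈ F)
    (hxx : c ≤ dist x x') (hyy : c ≤ dist y y') (hxy : dist x y ≤ T) :
    loewnerFunction μ n (T / c) ≤ modulus μ n (joining E F univ) := by
  refine iInf_le_of_le E (iInf_le_of_le F (iInf_le_of_le ⟨hE, ⟨x, hx, x', hx', ?_⟩, hF,
    ⟨y, hy, y', hy', ?_⟩, hd, ?_⟩ le_rfl))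
  · exact dist_pos.1 (hc.trans_le hxx)
  · exact dist_pos.1 (hc.trans_le hyy)
  · have hm : c ≤ min (Metric.diam E) (Metric.diam F) :=
      le_min (hxx.trans (Metric.dist_le_diam_of_mem hE.1.isBounded hx hx'))
        (hyy.trans (Metric.dist_le_diam_of_mem hF.1.isBounded hy hy'))
    exact div_le_div₀ hT ((setDist_le hx hy).trans hxy) hc hm

end Continua

/-! ### Comparison with ring families. -/

section RingFamilies

variable {X Y : Type*} [MetricSpace X] [MetricSpace Y] [MeasurableSpace X] {μ : Measure X} {p : ℝ}

/-- A path family whose images run from `B(y, r₁)` out of `B(y, r₂)` has at most the modulus of the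
ring family. -/
theorem modulus_le_ringFamily (f : C(X, Y)) (y : Y) {r₁ r₂ : ℝ} (hr : r₁ < r₂)
    {Γ : Set (Curve X)} (hΓ : ∀ γ ∈ Γ, ∃ s t, γ.left ≤ s ∧ s ≤ t ∧ t ≤ γ.right ∧
      dist (f (γ.toFun s)) y ≤ r₁ ∧ r₂ ≤ dist (f (γ.toFun t)) y) :
    modulus μ p Γ ≤ modulus μ p (ringFamily f y r₁ r₂) := by
  refine modulus_le_of_minorized fun γ hγ => ?_
  obtain ⟨s, t, hs, hst, ht, h1, h2⟩ := hΓ γ hγ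
  have hc : ContinuousOn (fun u => dist (f (γ.toFun u)) y) (Icc s t) :=
    (f.continuous.dist continuous_const).comp_continuousOn
      (γ.continuousOn.mono (Icc_subset_Icc hs ht))
  obtain ⟨a, b, ha, hab, hb, ha', hb', hmid⟩ := exists_crossing hst hc hr h1 h2
  refine ⟨γ.restrict a b hab (hs.trans ha) (hb.trans ht), ⟨?_, ?_, ?_⟩, a, b, hab, _, _, rfl⟩
  · simpa using! ha'
  · simpa using! hb'
  · intro u hu
    exact hmid u hu

end RingFamilies

/-! ### Finite mean oscillation and test functions of small energy. -/

section FiniteMeanOscillation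

/-- Passing to the smaller set magnifies the mean deviation from the average over `t` by at most the
ratio of the measures, hence by `K`. -/
theorem setAverage_le_add {Y : Type*} [MeasurableSpace Y] {ν : Measure Y}
    {q : Y → ℝ} {s t : Set Y} (hst : s ⊆ t)
    (hνt : ν t ≠ ∞) (hq : IntegrableOn q t ν) (hq0 : ∀ x, 0 ≤ q x)
    {A K : ℝ} (hA : 0 ≤ A) (hK : 0 ≤ K)
    (hosc : (⨍ z in t, |q z - ⨍ w in t, q w ∂ν| ∂ν) ≤ A) (hd : ν.real t ≤ K * ν.real s) :
    (⨍ z in s, q z ∂ν) ≤ (⨍ z in t, q z ∂ν) + A * K := by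
  set I := ⨍ z in t, q z ∂ν with hI
  have hI0 : 0 ≤ I := integral_nonneg hq0
  rcases (measureReal_nonneg (μ := ν) (s := s)).eq_or_lt with h0 | h0
  · rw [setAverage_eq, ← h0]
    simp only [inv_zero, zero_smul]
    positivity
  have hνs : ν s ≠ ∞ := ne_top_of_le_ne_top hνt (measure_mono hst)
  have hint : IntegrableOn (fun z => |q z - I|) t ν :=
    (hq.sub (integrableOn_const hνt)).abs
  have h1 : (∫ z in t, |q z - I| ∂ν) ≤ A * ν.real t := by
    rw [setAverage_eq, smul_eq_mul] at hosc
    have htpos : 0 < ν.real t := h0.trans_le (measureReal_mono hst hνt)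
    rwa [inv_mul_le_iff₀ htpos, mul_comm] at hosc
  have h2 : (∫ z in s, q z ∂ν) - ν.real s * I ≤ ∫ z in s, |q z - I| ∂ν := by
    have h3 : (∫ z in s, (q z - I) ∂ν) = (∫ z in s, q z ∂ν) - ν.real s * I := by
      rw [integral_sub (hq.mono_set hst) (integrableOn_const hνs), setIntegral_const, smul_eq_mul]
    rw [← h3]
    exact integral_mono ((hq.mono_set hst).sub (integrableOn_const hνs)) (hint.mono_set hst)
      fun z => le_abs_self _
  have h3 : (∫ z in s, |q z - I| ∂ν) ≤ ∫ z in t, |q z - I| ∂ν :=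
    setIntegral_mono_set hint (ae_of_all _ fun z => abs_nonneg _) hst.eventuallyLE
  rw [setAverage_eq, smul_eq_mul, inv_mul_le_iff₀ h0]
  nlinarith [mul_le_mul_of_nonneg_left hd hA]

variable {Y : Type*} [MetricSpace Y] [MeasurableSpace Y] {ν : Measure Y}

theorem HasFMOAt.exists_oscillation_le {Q : Y → ℝ≥0∞} {y : Y} (h : HasFMOAt ν Q y) :
    ∃ A : ℝ, 0 ≤ A ∧ ∀ᶠ ε in 𝓝[>] (0 : ℝ), (⨍ z in Metric.ball y ε,
      |(Q z).toReal - ⨍ w in Metric.ball y ε, (Q w).toReal ∂ν| ∂ν) ≤ A := by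
  obtain ⟨A, hA, -⟩ := ENNReal.lt_iff_exists_nnreal_btwn.1 h.2
  refine ⟨A, A.2, (eventually_lt_of_limsup_lt hA).mono fun ε hε => ?_⟩
  exact ((ENNReal.ofReal_lt_iff_lt_toReal (integral_nonneg fun z => abs_nonneg _)
    ENNReal.coe_ne_top).1 hε).le

/-- From one dyadic ball to the next the mean of `Q` grows by at most a multiple of `(k + 1) ^ (a -
2)`, so it is `O(k ^ (a - 1))`. Upper regularity turns the mean into an integral. -/
theorem lintegral_ball_le_of_hasFMOAt {a : ℝ} (ha : 2 ≤ a) (hreg : UpperRegular ν a)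
    (hlog : LogDoubling ν a) {Q : Y → ℝ≥0∞} (hQ : AEMeasurable Q ν) {y : Y}
    (hy : HasFMOAt ν Q y) : ∃ G : ℝ, 0 ≤ G ∧ ∀ᶠ k : ℕ in atTop,
      ∫⁻ z in Metric.ball y ((1 / 2) ^ k), Q z ∂ν ≤
        ENNReal.ofReal (G * (k : ℝ) ^ (a - 1) * ((1 / 2 : ℝ) ^ k) ^ a) := by
  obtain ⟨A, hA0, hA⟩ := hy.exists_oscillation_le
  obtain ⟨⟨ri, hri, hint⟩, -⟩ := hy
  obtain ⟨C, hC, rr, hrr, hreg⟩ := hreg y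
  obtain ⟨c, hc, rl, hrl, hlog⟩ := hlog y
  set b : ℕ → ℝ := fun k => (1 / 2) ^ k with hb
  have hb0 : ∀ k, 0 < b k := fun k => by positivity
  have hbt : Tendsto b atTop (𝓝[>] 0) := tendsto_nhdsWithin_iff.2
    ⟨tendsto_pow_atTop_nhds_zero_of_lt_one (by norm_num) (by norm_num),
      Eventually.of_forall hb0⟩
  set q : Y → ℝ := fun z => (Q z).toReal with hq
  set I : ℕ → ℝ := fun k => ⨍ z in Metric.ball y (b k), q z ∂ν with hI
  have hq0 : ∀ z, 0 ≤ q z := fun z => ENNReal.toReal_nonneg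
  have hI0 : ∀ k, 0 ≤ I k := fun k => integral_nonneg hq0
  have hqi : IntegrableOn q (Metric.ball y ri) ν :=
    integrable_toReal_of_lintegral_ne_top hQ.restrict hint
  have hev : ∀ᶠ k in atTop, (⨍ z in Metric.ball y (b k), |q z - I k| ∂ν) ≤ A ∧ b k < ri ∧
      b k < rr ∧ b k < rl ∧ 1 ≤ k := by
    have hlt : ∀ r > 0, ∀ᶠ k in atTop, b k < r := fun r hr =>
      (hbt.mono_right nhdsWithin_le_nhds).eventually_lt_const hr
    filter_upwards [hbt.eventually hA, hlt ri hri, hlt rr hrr, hlt rl hrl, eventually_ge_atTop 1]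
      with k h1 h2 h3 h4 h5 using ⟨h1, h2, h3, h4, h5⟩
  obtain ⟨k₀, hk₀⟩ := eventually_atTop.1 hev
  have hfin : ∀ k ≥ k₀, ν (Metric.ball y (b k)) ≠ ∞ := fun k hk =>
    ne_top_of_le_ne_top ENNReal.ofReal_ne_top (hreg _ (hb0 k) (hk₀ k hk).2.2.1)
  have hqk : ∀ k ≥ k₀, IntegrableOn q (Metric.ball y (b k)) ν := fun k hk =>
    hqi.mono_set (Metric.ball_subset_ball (hk₀ k hk).2.1.le)
  have hstep : ∀ k ≥ k₀, I (k + 1) ≤ I k + A * (c * ((k + 1 : ℕ) : ℝ) ^ (a - 2)) := by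
    intro k hk
    have hk1 := hk₀ (k + 1) (hk.trans k.le_succ)
    -- The logarithm is `(k + 1) log 2`, and `log 2 < 1`.
    have hlog2 : Real.log (1 / b (k + 1)) ≤ ((k + 1 : ℕ) : ℝ) := by
      rw [hb]
      simp only [one_div, inv_pow, inv_inv, Real.log_pow]
      nlinarith [Real.log_two_lt_d9, (Nat.cast_nonneg (k + 1) : (0 : ℝ) ≤ _)]
    have hlog0 : 0 ≤ Real.log (1 / b (k + 1)) := by
      rw [hb]
      simp only [one_div, inv_pow, inv_inv, Real.log_pow]
      have := Real.log_pos one_lt_two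
      positivity
    refine setAverage_le_add (Metric.ball_subset_ball ?_) (hfin k hk) (hqk k hk)
      hq0 hA0 (by positivity) (hk₀ k hk).1 ?_
    · exact pow_le_pow_of_le_one (by norm_num) (by norm_num) k.le_succ
    · have h1 := hlog (b (k + 1)) (hb0 _) hk1.2.2.2.1
      have h2 : 2 * b (k + 1) = b k := by simp only [hb, pow_succ]; ring
      rw [h2] at h1
      have h3 := ENNReal.toReal_mono (ENNReal.mul_ne_top ENNReal.ofReal_ne_top
        (hfin (k + 1) (hk.trans k.le_succ))) h1
      rw [ENNReal.toReal_mul, ENNReal.toReal_ofReal (by positivity)] at h3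
      refine h3.trans (mul_le_mul_of_nonneg_right ?_ ENNReal.toReal_nonneg)
      gcongr
  -- The first entry starts the induction (as `k₀ ≥ 1`), the second absorbs the increment of each
  -- step.
  set G := max (I k₀) (A * c) with hG
  have hG0 : 0 ≤ G := (hI0 k₀).trans (le_max_left _ _)
  have hgrow : ∀ k ≥ k₀, I k ≤ G * (k : ℝ) ^ (a - 1) := by
    intro k hk
    induction k, hk using Nat.le_induction with
    | base =>
      have h1 : (1 : ℝ) ≤ (k₀ : ℝ) ^ (a - 1) :=
        Real.one_le_rpow (by exact_mod_cast (hk₀ k₀ le_rfl).2.2.2.2) (by linarith)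
      nlinarith [le_max_left (I k₀) (A * c)]
    | succ k hk ih =>
      have hk1 : (0 : ℝ) < k := by exact_mod_cast (hk₀ k hk).2.2.2.2
      have e1 : (k : ℝ) ^ (a - 1) = k * (k : ℝ) ^ (a - 2) := by
        rw [← Real.rpow_one_add' hk1.le (by linarith)]; ring_nf
      have e2 : ((k + 1 : ℕ) : ℝ) ^ (a - 1) =
          ((k : ℝ) + 1) * ((k + 1 : ℕ) : ℝ) ^ (a - 2) := by
        push_cast
        rw [← Real.rpow_one_add' (by linarith) (by linarith)]; ring_nf
      have e3 : (k : ℝ) ^ (a - 2) ≤ ((k + 1 : ℕ) : ℝ) ^ (a - 2) := by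
        apply Real.rpow_le_rpow hk1.le (by push_cast; linarith) (by linarith)
      have e4 : 0 ≤ ((k + 1 : ℕ) : ℝ) ^ (a - 2) := by positivity
      calc I (k + 1) ≤ G * (k * (k : ℝ) ^ (a - 2)) + A * c * ((k + 1 : ℕ) : ℝ) ^ (a - 2) := by
            rw [← e1]; linarith [hstep k hk]
        _ ≤ G * (k * ((k + 1 : ℕ) : ℝ) ^ (a - 2)) + G * ((k + 1 : ℕ) : ℝ) ^ (a - 2) := by
            gcongr
            exact le_max_right _ _
        _ = _ := by rw [e2]; ring
  refine ⟨G * C, by positivity, eventually_atTop.2 ⟨k₀, fun k hk => ?_⟩⟩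
  have hae : ∀ᵐ z ∂ν.restrict (Metric.ball y (b k)), ENNReal.ofReal (q z) = Q z := by
    have : (∫⁻ z in Metric.ball y (b k), Q z ∂ν) ≠ ∞ := ne_top_of_le_ne_top hint
      (lintegral_mono_set (Metric.ball_subset_ball (hk₀ k hk).2.1.le))
    filter_upwards [ae_lt_top' hQ.restrict this] with z hz using ENNReal.ofReal_toReal hz.ne
  rw [← lintegral_congr_ae hae, ← ofReal_integral_eq_lintegral_ofReal (hqk k hk)
    (ae_of_all _ hq0)]
  apply ENNReal.ofReal_le_ofReal
  have hm : ν.real (Metric.ball y (b k)) ≤ C * b k ^ a :=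
    ENNReal.toReal_le_of_le_ofReal (by have := hb0 k; positivity)
      (hreg _ (hb0 k) (hk₀ k hk).2.2.1)
  have hav : (∫ z in Metric.ball y (b k), q z ∂ν) = ν.real (Metric.ball y (b k)) * I k := by
    rw [hI]
    simp only
    rw [← smul_eq_mul, measure_smul_setAverage _ (hfin k hk)]
  rw [hav]
  calc _ ≤ (C * b k ^ a) * (G * (k : ℝ) ^ (a - 1)) := by
        have := hb0 k
        gcongr
        · exact hI0 k
        · exact hgrow k hk
    _ = _ := by ring

variable [BorelSpace Y]

/-- Test functions that show that the right-hand side of the inverse Poletsky inequality over the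
rings `A(y, r₁, r₂)` can be made arbitrarily small as `r₁ → 0`. -/
theorem exists_test_function {a : ℝ} (ha : 2 ≤ a) (hreg : UpperRegular ν a)
    (hlog : LogDoubling ν a) {Q : Y → ℝ≥0∞} (hQ : AEMeasurable Q ν) {y : Y}
    (hy : HasFMOAt ν Q y) {r₂ ε : ℝ} (hr₂ : 0 < r₂) (hε : 0 < ε) :
    ∃ r₁, 0 < r₁ ∧ r₁ < r₂ ∧ ∃ η : ℝ → ℝ≥0∞, Measurable η ∧ 1 ≤ ∫⁻ r in Ioo r₁ r₂, η r ∧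
      ∫⁻ w, Q w * η (dist w y) ^ a ∂ν ≤ ENNReal.ofReal ε := by
  obtain ⟨G, hG0, hG⟩ := lintegral_ball_le_of_hasFMOAt ha hreg hlog hQ hy
  set b : ℕ → ℝ := fun k => (1 / 2) ^ k with hb
  have hb0 : ∀ k, 0 < b k := fun k => by positivity
  have hbanti : StrictAnti b := pow_right_strictAnti₀ (by norm_num) (by norm_num)
  have hbt : Tendsto b atTop (𝓝 0) :=
    tendsto_pow_atTop_nhds_zero_of_lt_one (by norm_num) (by norm_num)
  obtain ⟨k₀, hk₀⟩ := eventually_atTop.1 (hG.and (hbt.eventually_lt_const hr₂))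
  set H : ℕ → ℝ := fun K => ∑ k ∈ Finset.Ico k₀ K, 1 / ((k : ℝ) + 1) with hH
  have hHt : Tendsto H atTop atTop := by
    have h1 := tendsto_atTop_add_const_right atTop
      (-∑ k ∈ Finset.range k₀, 1 / ((k : ℝ) + 1)) Real.tendsto_sum_range_one_div_nat_succ_atTop
    refine h1.congr' ?_
    filter_upwards [eventually_ge_atTop k₀] with K hK
    rw [hH]
    simp only
    rw [Finset.sum_Ico_eq_sub _ hK, sub_eq_add_neg]
  have hlim : Tendsto (fun K => 2 ^ a * G * H K ^ (-(a - 1))) atTop (𝓝 (2 ^ a * G * 0)) :=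
    ((tendsto_rpow_neg_atTop (by linarith : 0 < a - 1)).comp hHt).const_mul _
  rw [mul_zero] at hlim
  obtain ⟨K, hKε, hHK, hkK⟩ := ((hlim.eventually_lt_const hε).and
    ((hHt.eventually_gt_atTop 0).and (eventually_ge_atTop k₀))).exists
  -- The `k`-th ring has width `2 ^ (-(k + 1))`, so it contributes `1 / ((k + 1) H K)` to the
  -- integral of `η`; these add up to `1`.
  set c : ℕ → ℝ := fun k => 2 ^ (k + 1) / ((k : ℝ) + 1) / H K with hc
  have hc0 : ∀ k, 0 < c k := fun k => by positivity
  have hcb : ∀ k, c k * b k = 2 / H K * ((k : ℝ) + 1)⁻¹ := fun k => by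
    simp only [hc, hb, pow_succ, one_div, inv_pow]
    field_simp
  set e : ℕ → ℝ → ℝ≥0∞ := fun k =>
    (Ioo (b (k + 1)) (b k)).indicator fun _ => ENNReal.ofReal (c k) with he
  -- A supremum is attained at one index, so its `a`-th power is at most the sum of the `a`-th
  -- powers.
  set η : ℝ → ℝ≥0∞ := fun r => (Finset.Ico k₀ K).sup fun k => e k r with hη
  have hηm : Measurable η := by
    have : η = (Finset.Ico k₀ K).sup e := by
      ext r
      rw [Finset.sup_apply]
    rw [this]
    exact Finset.sup_induction measurable_const (fun _ h _ h' => h.sup h')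
      fun k _ => measurable_const.indicator measurableSet_Ioo
  refine ⟨b K, hb0 K, (hbanti.antitone hkK).trans_lt (hk₀ k₀ le_rfl).2, η, hηm, ?_, ?_⟩
  · calc (1 : ℝ≥0∞) = ∑ k ∈ Finset.Ico k₀ K, ENNReal.ofReal (1 / ((k : ℝ) + 1) / H K) := by
          rw [← ENNReal.ofReal_sum_of_nonneg fun k _ => by positivity, ← Finset.sum_div,
            div_self hHK.ne', ENNReal.ofReal_one]
      _ ≤ ∑ k ∈ Finset.Ico k₀ K, ∫⁻ r in Ioo (b (k + 1)) (b k), η r := by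
          refine Finset.sum_le_sum fun k hk => ?_
          calc ENNReal.ofReal (1 / ((k : ℝ) + 1) / H K)
              = ∫⁻ r in Ioo (b (k + 1)) (b k), ENNReal.ofReal (c k) := by
                rw [setLIntegral_const, Real.volume_Ioo, ← ENNReal.ofReal_mul (hc0 k).le]
                congr 1
                have : b k - b (k + 1) = b k / 2 := by simp only [hb, pow_succ]; ring
                rw [this, ← mul_div_assoc, hcb]
                field_simp
            _ ≤ _ := by
                refine setLIntegral_mono hηm fun r hr => ?_
                refine le_trans ?_ (Finset.le_sup (f := fun k => e k r) hk)
                simp [he, indicator_of_mem hr]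
      _ = ∫⁻ r in ⋃ k ∈ Finset.Ico k₀ K, Ioo (b (k + 1)) (b k), η r := by
          rw [lintegral_biUnion_finset]
          · exact (hbanti.antitone.pairwise_disjoint_on_Ioo_succ).set_pairwise _
          · exact fun k _ => measurableSet_Ioo
      _ ≤ _ := by
          refine lintegral_mono_set (iUnion₂_subset fun k hk => Ioo_subset_Ioo ?_ ?_)
          · exact hbanti.antitone (Finset.mem_Ico.1 hk).2
          · exact (hk₀ k (Finset.mem_Ico.1 hk).1).2.le
  · have ha0 : 0 < a := by linarith
    calc ∫⁻ w, Q w * η (dist w y) ^ a ∂ν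
        ≤ ∫⁻ w, ∑ k ∈ Finset.Ico k₀ K, (Metric.ball y (b k)).indicator
            (fun w => Q w * ENNReal.ofReal (c k) ^ a) w ∂ν := by
          refine lintegral_mono fun w => ?_
          rcases (Finset.Ico k₀ K).eq_empty_or_nonempty with h0 | hne
          · simp [hη, h0, ENNReal.zero_rpow_of_pos ha0]
          obtain ⟨k, hk, hke⟩ := Finset.exists_mem_eq_sup _ hne fun k => e k (dist w y)
          have hke' : η (dist w y) = e k (dist w y) := hke
          refine le_trans ?_ (Finset.single_le_sum (fun _ _ => zero_le) hk)
          rw [hke']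
          by_cases hw : dist w y ∈ Ioo (b (k + 1)) (b k)
          · rw [indicator_of_mem (Metric.mem_ball.2 hw.2)]
            simp [he, indicator_of_mem hw]
          · simp [he, indicator_of_notMem hw, ENNReal.zero_rpow_of_pos ha0]
      _ = ∑ k ∈ Finset.Ico k₀ K, (∫⁻ w in Metric.ball y (b k), Q w ∂ν) *
            ENNReal.ofReal (c k) ^ a := by
          rw [lintegral_finsetSum' _ fun k _ =>
            (hQ.mul_const _).indicator measurableSet_ball]
          refine Finset.sum_congr rfl fun k _ => ?_
          rw [lintegral_indicator measurableSet_ball, lintegral_mul_const'' _ hQ.restrict]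
      _ ≤ ∑ k ∈ Finset.Ico k₀ K, ENNReal.ofReal ((2 / H K) ^ a * G * (1 / ((k : ℝ) + 1))) := by
          refine Finset.sum_le_sum fun k hk => ?_
          refine (mul_le_mul_left (hk₀ k (Finset.mem_Ico.1 hk).1).1 _).trans ?_
          rw [ENNReal.ofReal_rpow_of_pos (hc0 k), ← ENNReal.ofReal_mul (by positivity)]
          apply ENNReal.ofReal_le_ofReal
          have h1 : (b k) ^ a * c k ^ a = (2 / H K) ^ a * (((k : ℝ) + 1) ^ a)⁻¹ := by
            rw [mul_comm, ← Real.mul_rpow (hc0 k).le (hb0 k).le, hcb,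
              Real.mul_rpow (by positivity) (by positivity), Real.inv_rpow (by positivity)]
          have h2 : (k : ℝ) ^ (a - 1) ≤ ((k : ℝ) + 1) ^ (a - 1) :=
            Real.rpow_le_rpow (by positivity) (by linarith) (by linarith)
          have h3 : ((k : ℝ) + 1) ^ (a - 1) * (((k : ℝ) + 1) ^ a)⁻¹ = 1 / ((k : ℝ) + 1) := by
            rw [Real.rpow_sub_one (by positivity)]
            field_simp
          calc G * (k : ℝ) ^ (a - 1) * (b k) ^ a * c k ^ a
              -- The growth `k ^ (a - 1)` of the means leaves a harmonic term. Summing gives `2 ^ a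
              -- * G * H K ^ (1 - a)`, small because the harmonic series diverges.
              = G * (2 / H K) ^ a * ((k : ℝ) ^ (a - 1) * (((k : ℝ) + 1) ^ a)⁻¹) := by
                rw [mul_assoc, h1]; ring
            _ ≤ G * (2 / H K) ^ a * (1 / ((k : ℝ) + 1)) := by
                rw [← h3]
                gcongr
            _ = _ := by ring
      _ = ENNReal.ofReal (2 ^ a * G * H K ^ (-(a - 1))) := by
          rw [← ENNReal.ofReal_sum_of_nonneg fun k _ => by positivity, ← Finset.mul_sum]
          congr 1
          change (2 / H K) ^ a * G * H K = _
          rw [Real.div_rpow (by norm_num) hHK.le, neg_sub, Real.rpow_sub hHK, Real.rpow_one]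
          ring
      _ ≤ ENNReal.ofReal ε := ENNReal.ofReal_le_ofReal hKε.le

/-- Under the inverse Poletsky inequality at a point of finite mean oscillation of `Q`, the ring
families around this point have small modulus, uniformly in the mapping. -/
theorem exists_modulus_ringFamily_le {a' : ℝ} (ha : 2 ≤ a') (hreg : UpperRegular ν a')
    (hlog : LogDoubling ν a') {Q : Y → ℝ≥0∞} (hQ : AEMeasurable Q ν) {y : Y}
    (hy : HasFMOAt ν Q y) {r₂ ε : ℝ} (hr₂ : 0 < r₂) (hε : 0 < ε) :
    ∃ r₁, 0 < r₁ ∧ r₁ < r₂ ∧ ∀ {X : Type*} [MetricSpace X] [MeasurableSpace X] (μ : Measure X)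
      (a : ℝ) (f : C(X, Y)), InversePoletskyAt μ ν a a' Q f y → (∃ x, r₂ < dist (f x) y) →
      modulus μ a (ringFamily f y r₁ r₂) ≤ ENNReal.ofReal ε := by
  obtain ⟨r₁, h0, h1, η, hη, hη1, hle⟩ := exists_test_function ha hreg hlog hQ hy hr₂ hε
  exact ⟨r₁, h0, h1, fun μ a f hf hx => (hf r₁ r₂ h0 h1 hx η hη hη1).trans
    ((setLIntegral_le_lintegral _ _).trans hle)⟩

end FiniteMeanOscillation

/-! ### Points of zero capacity and blow-up of the modulus. -/

section ZeroCapacity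

variable {X Y : Type*} [MetricSpace X] [MetricSpace Y]

theorem joining_mono {E E' F F' G G' : Set X} (hE : E ⊆ E') (hF : F ⊆ F') (hG : G ⊆ G') :
    joining E F G ⊆ joining E' F' G' :=
  fun _ h => ⟨hE h.1, hF h.2.1, fun t ht => hG (h.2.2 t ht)⟩

theorem Curve.exists_dist_eq (γ : Curve X) {x : X} {r : ℝ} (hl : dist (γ.toFun γ.left) x ≤ r)
    (hr : r ≤ dist (γ.toFun γ.right) x) : ∃ t ∈ Icc γ.left γ.right, dist (γ.toFun t) x = r :=
  intermediate_value_Icc γ.left_lt_right.le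
    ((continuous_id.dist continuous_const).comp_continuousOn γ.continuousOn) ⟨hl, hr⟩

theorem IsContinuum.exists_dist_eq {C : Set X} (hC : IsContinuum C) {x : X} {r : ℝ}
    (h1 : ∃ z ∈ C, dist z x ≤ r) (h2 : ∃ z ∈ C, r ≤ dist z x) : ∃ z ∈ C, dist z x = r := by
  obtain ⟨z, hz, hzr⟩ := h1
  obtain ⟨w, hw, hwr⟩ := h2
  exact hC.2.isPreconnected.intermediate_value hz hw
    (continuous_id.dist continuous_const).continuousOn ⟨hzr, hwr⟩

/-- A continuum that crosses the ring `A(x, σ, 2σ)` contains a subcontinuum of diameter at least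
`σ / 2` in the closed ring. -/
theorem IsContinuum.exists_subcontinuum_ring {C : Set X} (hC : IsContinuum C) {x : X} {σ : ℝ}
    (hσ : 0 < σ) (h1 : ∃ z ∈ C, dist z x ≤ σ) (h2 : ∃ z ∈ C, 2 * σ ≤ dist z x) :
    ∃ P ⊆ C, IsContinuum P ∧ (∀ z ∈ P, σ ≤ dist z x ∧ dist z x ≤ 2 * σ) ∧
      ∃ z ∈ P, ∃ w ∈ P, σ / 2 ≤ dist z w := by
  obtain ⟨z, hz, hzσ⟩ := h1
  obtain ⟨w, hw, hwσ⟩ := h2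
  obtain ⟨c, hc, hcσ⟩ := hC.exists_dist_eq (x := x) (r := 3 / 2 * σ) ⟨z, hz, by linarith⟩
    ⟨w, hw, by linarith⟩
  obtain ⟨P, hP, hPc, hcP, v, hv, hvr⟩ := hC.exists_subcontinuum hc (half_pos hσ)
    ⟨w, hw, by linarith [dist_triangle w c x]⟩
  refine ⟨P, hP.trans inter_subset_left, hPc, fun u hu => ?_, v, hv, c, hcP, hvr.ge⟩
  have h3 : dist u c ≤ σ / 2 := (hP hu).2
  constructor
  · linarith [dist_triangle c u x, dist_comm u c]
  · linarith [dist_triangle u c x]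

variable [MeasurableSpace X] {μ : Measure X} {p : ℝ}

/-- The point `x` has zero `p`-capacity: the paths that join small balls around `x` to the
complement of a fixed ball have small modulus. -/
def HasZeroCapacity (μ : Measure X) (p : ℝ) (x : X) : Prop :=
  ∀ R > (0 : ℝ), ∀ ε > (0 : ℝ), ∃ s > (0 : ℝ),
    modulus μ p (joining (Metric.ball x s) (Metric.ball x R)ᶜ univ) ≤ ENNReal.ofReal ε

/-- A discrete mapping with small ring moduli at `f x` forces `x` to have zero capacity. -/
theorem hasZeroCapacity_of_ringFamily [LocallyCompactSpace X] (hp : 0 < p) (f : C(X, Y)) (x : X)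
    (hdisc : DiscreteTopology (f ⁻¹' {f x}))
    (hsmall : ∀ r₂ > (0 : ℝ), ∀ ε > (0 : ℝ), ∃ r₁ > (0 : ℝ), r₁ < r₂ ∧
      ((∃ z, r₂ < dist (f z) (f x)) →
        modulus μ p (ringFamily f (f x) r₁ r₂) ≤ ENNReal.ofReal ε)) :
    HasZeroCapacity μ p x := by
  intro R hR ε hε
  obtain ⟨ρ₁, hρ₁, hcomp⟩ := Metric.exists_isCompact_closedBall x
  -- Discreteness isolates `x` in its fibre, so a small compact sphere around `x` has image at
  -- positive distance `e` from `f x`.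
  obtain ⟨ρ₂, hρ₂, hiso⟩ := Metric.isOpen_singleton_iff.1
    (isOpen_discrete ({⟨x, rfl⟩} : Set (f ⁻¹' {f x})))
  obtain ⟨ρ, hρ0, hρ⟩ := exists_between (lt_min (lt_min hρ₁ hρ₂) hR)
  simp only [lt_min_iff] at hρ
  have hsph : IsCompact (Metric.sphere x ρ) := hcomp.of_isClosed_subset Metric.isClosed_sphere
    (Metric.sphere_subset_closedBall.trans (Metric.closedBall_subset_closedBall hρ.1.1.le))
  have hnot : f x ∉ f '' Metric.sphere x ρ := by
    rintro ⟨z, hz, hzx⟩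
    have h1 := hiso ⟨z, hzx⟩ ((Metric.mem_sphere.1 hz).trans_lt hρ.1.2)
    obtain rfl : z = x := Subtype.ext_iff.1 h1
    rw [Metric.mem_sphere, dist_self] at hz
    exact hρ0.ne hz
  obtain ⟨e, he, hball⟩ := Metric.isOpen_iff.1
    (hsph.image f.continuous).isClosed.isOpen_compl (f x) hnot
  have hfar : ∀ z, dist z x = ρ → e ≤ dist (f z) (f x) := fun z hz => by
    by_contra! hcon
    exact hball (Metric.mem_ball.2 hcon) ⟨z, hz, rfl⟩
  obtain ⟨r₁, hr₁, hr₁₂, hmod⟩ := hsmall (e / 2) (by linarith) ε hε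
  obtain ⟨s, hs, hcont⟩ := Metric.continuous_iff.1 f.continuous x r₁ hr₁
  refine ⟨min s ρ, lt_min hs hρ0, ?_⟩
  have hcross : ∀ γ ∈ joining (Metric.ball x (min s ρ)) (Metric.ball x R)ᶜ univ,
      dist (f (γ.toFun γ.left)) (f x) ≤ r₁ ∧
      ∃ t ∈ Icc γ.left γ.right, e ≤ dist (f (γ.toFun t)) (f x) := by
    intro γ hγ
    have hl := lt_min_iff.1 (Metric.mem_ball.1 hγ.1)
    have hr : R ≤ dist (γ.toFun γ.right) x := by simpa using hγ.2.1
    obtain ⟨t, ht, htρ⟩ := γ.exists_dist_eq hl.2.le (hρ.2.le.trans hr)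
    exact ⟨(hcont _ hl.1).le, t, ht, hfar _ htρ⟩
  rcases (joining (Metric.ball x (min s ρ)) (Metric.ball x R)ᶜ univ).eq_empty_or_nonempty
    with h0 | ⟨γ, hγ⟩
  · rw [h0, modulus_empty hp]
    exact zero_le
  · obtain ⟨-, t, -, ht⟩ := hcross γ hγ
    refine le_trans ?_ (hmod ⟨γ.toFun t, by linarith⟩)
    refine modulus_le_ringFamily f (f x) hr₁₂ fun γ hγ => ?_
    obtain ⟨hl, t, ht, het⟩ := hcross γ hγ
    exact ⟨γ.left, t, le_rfl, ht.1, ht.2, hl, by linarith⟩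

/-- In a space with a positive Loewner function, at a point of zero capacity, every function that
is admissible for the paths joining two large continua close to this point has large energy. -/
theorem HasZeroCapacity.le_setLIntegral_of_admissible [BorelSpace X] (hp : 0 < p) {x : X}
    (hcap : HasZeroCapacity μ p x) {c : ℝ} (hc : 0 < c)
    (hL : ENNReal.ofReal c ≤ loewnerFunction μ p 8) (N : ℕ) : ∀ R > (0 : ℝ), ∃ s > (0 : ℝ), s ≤ R ∧
      ∀ C₁ C₂ : Set X, IsContinuum C₁ → IsContinuum C₂ → Disjoint C₁ C₂ →
      (∃ z ∈ C₁, dist z x < s) → (∃ z ∈ C₁, R ≤ dist z x) →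
      (∃ z ∈ C₂, dist z x < s) → (∃ z ∈ C₂, R ≤ dist z x) →
      ∀ ρ, Admissible (joining C₁ C₂ univ) ρ →
        N * ENNReal.ofReal (c / 2) ≤ ∫⁻ z in Metric.ball x R \ Metric.ball x s, ρ z ^ p ∂μ := by
  induction N with
  | zero => exact fun R hR => ⟨R, hR, le_rfl, by simp⟩
  | succ N ih =>
  intro R hR
  obtain ⟨s₁, hs₁, hM₁⟩ := hcap R hR (c / 4) (by linarith)
  -- The closed ring between radii `σ` and `2σ` then lies in both `B(x, s₁)` and `B(x, R)`.
  obtain ⟨σ, hσ0, hσ⟩ := exists_between (lt_min (half_pos hs₁) (half_pos hR))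
  simp only [lt_min_iff] at hσ
  obtain ⟨s₂, hs₂, hM₂⟩ := hcap σ hσ0 (c / 4) (by linarith)
  set s' := min s₂ σ with hs'
  have hs'0 : 0 < s' := lt_min hs₂ hσ0
  have hs'σ : s' ≤ σ := min_le_right _ _
  obtain ⟨s, hs, hss', hIH⟩ := ih s' hs'0
  refine ⟨s, hs, by linarith, ?_⟩
  rintro C₁ C₂ hC₁ hC₂ hdisj ⟨z₁, hz₁, hz₁s⟩ ⟨w₁, hw₁, hw₁R⟩ ⟨z₂, hz₂, hz₂s⟩ ⟨w₂, hw₂, hw₂R⟩ ρ hρ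
  have hIH := hIH C₁ C₂ hC₁ hC₂ hdisj ⟨z₁, hz₁, hz₁s⟩ ⟨w₁, hw₁, by linarith⟩
    ⟨z₂, hz₂, hz₂s⟩ ⟨w₂, hw₂, by linarith⟩ ρ hρ
  obtain ⟨P₁, hPC₁, hP₁, hr₁, u₁, hu₁, v₁, hv₁, huv₁⟩ := hC₁.exists_subcontinuum_ring hσ0
    ⟨z₁, hz₁, by linarith⟩ ⟨w₁, hw₁, by linarith⟩
  obtain ⟨P₂, hPC₂, hP₂, hr₂, u₂, hu₂, v₂, hv₂, huv₂⟩ := hC₂.exists_subcontinuum_ring hσ0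
    ⟨z₂, hz₂, by linarith⟩ ⟨w₂, hw₂, by linarith⟩
  have hlow : ENNReal.ofReal c ≤ modulus μ p (joining P₁ P₂ univ) := by
    refine hL.trans ?_
    -- Points of the two subcontinua are at most `4σ` apart, and the diameters are at least `σ / 2`.
    have h8 : 4 * σ / (σ / 2) = 8 := by field_simp; norm_num
    rw [← h8]
    refine loewnerFunction_le_modulus hP₁ hP₂ (hdisj.mono hPC₁ hPC₂) (half_pos hσ0) (by linarith)
      hu₁ hv₁ hu₂ hv₂ huv₁ huv₂ ?_
    linarith [dist_triangle_right u₁ u₂ x, (hr₁ u₁ hu₁).2, (hr₂ u₂ hu₂).2]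
  set A := Metric.ball x R \ Metric.ball x s' with hA
  set Γ₀ : Set (Curve X) := {γ | γ ∈ joining P₁ P₂ univ ∧ ∀ t ∈ Icc γ.left γ.right, γ.toFun t ∈ A}
    with hΓ₀
  set Γ₁ : Set (Curve X) := {γ | γ ∈ joining P₁ P₂ univ ∧
    ∃ t ∈ Icc γ.left γ.right, γ.toFun t ∉ Metric.ball x R} with hΓ₁
  set Γ₂ : Set (Curve X) := {γ | γ ∈ joining P₁ P₂ univ ∧
    ∃ t ∈ Icc γ.left γ.right, γ.toFun t ∈ Metric.ball x s'} with hΓ₂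
  -- Paths leaving the shell outwards or inwards cost at most `c / 4` each by zero capacity. Of the
  -- Loewner bound `c`, at least `c / 2` remains for paths inside the shell.
  have hsub : joining P₁ P₂ univ ⊆ Γ₀ ∪ (Γ₁ ∪ Γ₂) := by
    intro γ hγ
    by_cases h1 : ∃ t ∈ Icc γ.left γ.right, γ.toFun t ∉ Metric.ball x R
    · exact Or.inr (Or.inl ⟨hγ, h1⟩)
    by_cases h2 : ∃ t ∈ Icc γ.left γ.right, γ.toFun t ∈ Metric.ball x s'
    · exact Or.inr (Or.inr ⟨hγ, h2⟩)
    push Not at h1 h2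
    exact Or.inl ⟨hγ, fun t ht => ⟨h1 t ht, h2 t ht⟩⟩
  have hΓ₁le : modulus μ p Γ₁ ≤ ENNReal.ofReal (c / 4) := by
    refine (modulus_le_of_minorized fun γ hγ => ?_).trans hM₁
    obtain ⟨hγ, t, ht, htR⟩ := hγ
    have hl : γ.toFun γ.left ∈ Metric.ball x s₁ := by
      rw [Metric.mem_ball]
      linarith [(hr₁ _ hγ.1).2]
    have hlt : γ.left < t := lt_of_le_of_ne ht.1 (by
      rintro rfl
      apply htR
      rw [Metric.mem_ball]
      linarith [(hr₁ _ hγ.1).2])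
    exact ⟨γ.restrict γ.left t hlt le_rfl ht.2, ⟨hl, htR, fun _ _ => mem_univ _⟩,
      γ.left, t, hlt, le_rfl, ht.2, rfl⟩
  have hΓ₂le : modulus μ p Γ₂ ≤ ENNReal.ofReal (c / 4) := by
    refine (modulus_le_of_minorized fun γ hγ => ?_).trans hM₂
    obtain ⟨hγ, t, ht, hts⟩ := hγ
    have hr : γ.toFun γ.right ∈ (Metric.ball x σ)ᶜ := by
      simpa using (hr₂ _ hγ.2.1).1
    have hlt : t < γ.right := lt_of_le_of_ne ht.2 (by
      rintro rfl
      exact hr (Metric.ball_subset_ball hs'σ hts))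
    exact ⟨γ.restrict t γ.right hlt ht.1 le_rfl,
      ⟨Metric.ball_subset_ball (min_le_left _ _) hts, hr, fun _ _ => mem_univ _⟩,
      t, γ.right, hlt, ht.1, le_rfl, rfl⟩
  have hAm : MeasurableSet A := measurableSet_ball.diff measurableSet_ball
  have hΓ₀le : modulus μ p Γ₀ ≤ ∫⁻ z in A, ρ z ^ p ∂μ :=
    modulus_le_setLIntegral hp hAm hρ
      (fun γ hγ => joining_mono hPC₁ hPC₂ le_rfl hγ.1) fun γ hγ => hγ.2
  have hmain : ENNReal.ofReal (c / 2) ≤ ∫⁻ z in A, ρ z ^ p ∂μ := by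
    have h1 : ENNReal.ofReal (c / 2) + ENNReal.ofReal (c / 2) ≤
        (∫⁻ z in A, ρ z ^ p ∂μ) + ENNReal.ofReal (c / 2) := by
      calc ENNReal.ofReal (c / 2) + ENNReal.ofReal (c / 2) = ENNReal.ofReal c := by
            rw [← ENNReal.ofReal_add (by linarith) (by linarith), add_halves]
        _ ≤ modulus μ p Γ₀ + (modulus μ p Γ₁ + modulus μ p Γ₂) :=
            hlow.trans ((modulus_mono hsub).trans ((modulus_union_le _ _).trans
              (add_le_add_right (modulus_union_le _ _) _)))
        _ ≤ (∫⁻ z in A, ρ z ^ p ∂μ) + (ENNReal.ofReal (c / 4) + ENNReal.ofReal (c / 4)) := by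
            gcongr
        _ = _ := by
            rw [← ENNReal.ofReal_add (by linarith) (by linarith)]
            ring_nf
    exact (ENNReal.add_le_add_iff_right ENNReal.ofReal_ne_top).1 h1
  -- The new shell is disjoint from the `N` shells inside `B(x, s')`, so the energies add.
  have hunion : Metric.ball x R \ Metric.ball x s = A ∪ (Metric.ball x s' \ Metric.ball x s) := by
    rw [hA, sdiff_union_sdiff_cancel (Metric.ball_subset_ball (by linarith))
      (Metric.ball_subset_ball hss')]
  rw [hunion, lintegral_union (measurableSet_ball.diff measurableSet_ball)
    (disjoint_left.2 fun z hz hz' => hz.2 hz'.1), Nat.cast_succ, add_mul, one_mul, add_comm]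
  gcongr

/-- At a point of zero capacity of a Loewner space, the modulus of the paths joining two large
continua tends to infinity as the continua approach the point. -/
theorem HasZeroCapacity.exists_lt_modulus [BorelSpace X] (hp : 0 < p) {x : X}
    (hcap : HasZeroCapacity μ p x) (hL : 0 < loewnerFunction μ p 8) {M : ℝ≥0∞} (hM : M ≠ ∞)
    {R : ℝ} (hR : 0 < R) : ∃ s > (0 : ℝ),
      ∀ C₁ C₂ : Set X, IsContinuum C₁ → IsContinuum C₂ → Disjoint C₁ C₂ →
      (∃ z ∈ C₁, dist z x < s) → (∃ z ∈ C₁, R ≤ dist z x) →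
      (∃ z ∈ C₂, dist z x < s) → (∃ z ∈ C₂, R ≤ dist z x) →
      M < modulus μ p (joining C₁ C₂ univ) := by
  obtain ⟨c, hc, hcL⟩ := ENNReal.lt_iff_exists_nnreal_btwn.1 hL
  have hc0 : (0 : ℝ) < c := by exact_mod_cast hc
  obtain ⟨N, hN⟩ := ENNReal.exists_nat_mul_gt (a := ENNReal.ofReal (c / 2)) (b := M)
    (by simpa using hc0) hM
  obtain ⟨s, hs, -, h⟩ := hcap.le_setLIntegral_of_admissible hp hc0
    (by simpa using hcL.le) N R hR
  refine ⟨s, hs, fun C₁ C₂ h1 h2 h3 h4 h5 h6 h7 => hN.trans_le (le_iInf₂ fun ρ hρ => ?_)⟩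
  exact (h C₁ C₂ h1 h2 h3 h4 h5 h6 h7 ρ hρ).trans (setLIntegral_le_lintegral _ _)

end ZeroCapacity

/-! ### Continua leaving the target domain. -/

section Escape

variable {Y : Type*} [MetricSpace Y] {D' : Set Y}

theorem isContinuum_range_path {a b : Y} (p : Path a b) : IsContinuum (range p) :=
  ⟨isCompact_range p.continuous, isConnected_range p.continuous⟩

/-- Under condition **A**, two different points of the closure of a domain lie in disjoint continua
that are not contained in the domain. -/
theorem ConditionA.exists_disjoint_continua (hA : ConditionA D') (hD' : IsMetricDomain D')
    (hb : (frontier D').Nontrivial) {y₁ y₂ : Y} (h₁ : y₁ ∈ closure D') (h₂ : y₂ ∈ closure D')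
    (hne : y₁ ≠ y₂) : ∃ K₁ K₂, IsContinuum K₁ ∧ IsContinuum K₂ ∧ Disjoint K₁ K₂ ∧ y₁ ∈ K₁ ∧
      y₂ ∈ K₂ ∧ ¬ K₁ ⊆ D' ∧ ¬ K₂ ⊆ D' := by
  have hfr : ∀ z ∈ frontier D', z ∉ D' := fun z hz hzD => by
    rw [hD'.1.frontier_eq] at hz
    exact hz.2 hzD
  have hnefr : ∀ y ∈ D', ∀ z ∈ frontier D', y ≠ z := by
    rintro y hy _ hz rfl
    exact hfr _ hz hy
  have hsing : ∀ y : Y, IsContinuum {y} := fun y => ⟨isCompact_singleton, isConnected_singleton⟩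
  -- A point outside `D'` is its own escaping continuum. The path from `y` must then avoid `z`,
  -- which is forced by making `z` the end of the second path, from an auxiliary point `c`.
  have hone : ∀ y ∈ D', ∀ z ∈ closure D', z ∉ D' →
      ∃ K, IsContinuum K ∧ y ∈ K ∧ z ∉ K ∧ ¬ K ⊆ D' := by
    intro y hy z hz hzD
    obtain ⟨b, hbf, hbz⟩ := hb.exists_ne z
    obtain ⟨c, hc, hcy⟩ : ∃ c ∈ D', c ≠ y := by
      by_contra! hcon
      have : D' = {y} := subset_antisymm hcon (singleton_subset_iff.2 hy)
      rw [this, closure_singleton] at hz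
      exact hzD (by rwa [this])
    obtain ⟨p, q, -, -, hpq⟩ := hA y b c z hy (frontier_subset_closure hbf) hc hz
      (hnefr y hy b hbf) hcy.symm (by rintro rfl; exact hzD hy) (hnefr c hc b hbf).symm hbz
      (by rintro rfl; exact hzD hc)
    exact ⟨range p, isContinuum_range_path p, ⟨0, p.source⟩,
      fun hzp => disjoint_left.1 hpq hzp ⟨1, q.target⟩, fun h => hfr b hbf (h ⟨1, p.target⟩)⟩
  by_cases hy₁ : y₁ ∈ D' <;> by_cases hy₂ : y₂ ∈ D'
  · obtain ⟨b₁, hb₁, b₂, hb₂, hbb⟩ := hb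
    obtain ⟨p, q, -, -, hpq⟩ := hA y₁ b₁ y₂ b₂ hy₁ (frontier_subset_closure hb₁) hy₂
      (frontier_subset_closure hb₂) (hnefr _ hy₁ _ hb₁) hne (hnefr _ hy₁ _ hb₂)
      (hnefr _ hy₂ _ hb₁).symm hbb (hnefr _ hy₂ _ hb₂)
    exact ⟨range p, range q, isContinuum_range_path p, isContinuum_range_path q, hpq,
      ⟨0, p.source⟩, ⟨0, q.source⟩, fun h => hfr b₁ hb₁ (h ⟨1, p.target⟩),
      fun h => hfr b₂ hb₂ (h ⟨1, q.target⟩)⟩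
  · obtain ⟨K, hK, hyK, hzK, hKD⟩ := hone y₁ hy₁ y₂ h₂ hy₂
    exact ⟨K, {y₂}, hK, hsing _, disjoint_singleton_right.2 hzK, hyK, rfl, hKD,
      fun h => hy₂ (h rfl)⟩
  · obtain ⟨K, hK, hyK, hzK, hKD⟩ := hone y₂ hy₂ y₁ h₁ hy₁
    exact ⟨{y₁}, K, hsing _, hK, disjoint_singleton_left.2 hzK, rfl, hyK, fun h => hy₁ (h rfl),
      hKD⟩
  · exact ⟨{y₁}, {y₂}, hsing _, hsing _, by simpa using hne, rfl, rfl, fun h => hy₁ (h rfl),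
      fun h => hy₂ (h rfl)⟩

/-- A continuum through `y` that is not contained in `D'` can be extended to continua through all
points near `y`, inside a compact subset of any given neighbourhood. -/
theorem exists_continua_of_nhds [LocallyPathConnectedSpace Y] [LocallyCompactSpace Y] {K O : Set Y}
    (hK : IsContinuum K) (hO : IsOpen O) (hKO : K ⊆ O) {y : Y} (hy : y ∈ K) (hKD : ¬ K ⊆ D') :
    ∃ B ⊆ O, IsCompact B ∧ ∃ U ∈ 𝓝 y, ∀ u ∈ U, ∃ β ⊆ B, IsContinuum β ∧ u ∈ β ∧ ¬ β ⊆ D' := by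
  obtain ⟨N, hN, hNO, hNc⟩ := local_compact_nhds (hO.mem_nhds (hKO hy))
  obtain ⟨U, ⟨hU, hUp⟩, hUN⟩ := (path_connected_basis y).mem_iff.1 hN
  refine ⟨K ∪ N, union_subset hKO hNO, hK.1.union hNc, U, hU, fun u hu => ?_⟩
  obtain ⟨γ, hγ⟩ := hUp.joinedIn y (mem_of_mem_nhds hU) u hu
  have hr := isContinuum_range_path γ
  refine ⟨K ∪ range γ, union_subset_union_right K ?_, ⟨hK.1.union hr.1, hK.2.union ?_ hr.2⟩,
    Or.inr ⟨1, γ.target⟩, fun h => hKD (subset_union_left.trans h)⟩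
  · rintro _ ⟨t, rfl⟩
    exact hUN (hγ t)
  · exact ⟨y, hy, 0, γ.source⟩

end Escape

/-! ### Equicontinuity of the class. -/

section Equicontinuity

variable {X Y : Type*} [MetricSpace X] [MeasurableSpace X] [MetricSpace Y]
  [MeasurableSpace Y] {μ : Measure X} {ν : Measure Y} {a a' : ℝ} {D' : Set Y}
  {Q : Y → ℝ≥0∞}

/-- The constant test function `2 / d` suffices; the bound depends on neither `f` nor `y`. -/
theorem InversePoletskyAt.modulus_le {f : C(X, Y)} {y : Y} (hf : InversePoletskyAt μ ν a a' Q f y)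
    (hfD : ∀ x, f x ∈ D') {d : ℝ} (hd : 0 < d) (hx : ∃ x, d < dist (f x) y) :
    modulus μ a (ringFamily f y (d / 2) d) ≤
      (∫⁻ w in D', Q w ∂ν) * ENNReal.ofReal (2 / d) ^ a' := by
  refine (hf (d / 2) d (by linarith) (by linarith) hx (fun _ => ENNReal.ofReal (2 / d))
    measurable_const ?_).trans ?_
  · rw [setLIntegral_const, Real.volume_Ioo, ← ENNReal.ofReal_mul (by positivity)]
    have : 2 / d * (d - d / 2) = 1 := by field_simp; norm_num
    rw [this, ENNReal.ofReal_one]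
  · refine (lintegral_mono_set (inter_subset_left.trans (range_subset_iff.2 hfD))).trans ?_
    rw [lintegral_mul_const']
    rw [ENNReal.ofReal_rpow_of_pos (by positivity)]
    exact ENNReal.ofReal_ne_top

/-- Equicontinuity, at a point of zero capacity of a Loewner space, of the open maps into a domain
with condition **A** that satisfy an inverse Poletsky inequality with an integrable weight. -/
theorem exists_forall_dist_lt [BorelSpace X] [LocallyCompactSpace X] [LocallyPathConnectedSpace Y]
    [LocallyCompactSpace Y] (ha : 0 < a) (ha' : 0 ≤ a') (hL : 0 < loewnerFunction μ a 8)
    (hD' : IsMetricDomain D')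
    (hA : ConditionA D') (hb : (frontier D').Nontrivial) (hcomp : IsCompact (closure D'))
    (hQ : ∫⁻ w in D', Q w ∂ν ≠ ∞) {F : Set C(X, Y)} (hFD : ∀ f ∈ F, ∀ x, f x ∈ D')
    (hFo : ∀ f ∈ F, IsOpenMap f) (hFP : ∀ f ∈ F, ∀ y, InversePoletskyAt μ ν a a' Q f y)
    {x₀ : X} (hcap : HasZeroCapacity μ a x₀) {ε : ℝ} (hε : 0 < ε) :
    ∃ s > (0 : ℝ), ∀ f ∈ F, ∀ x, dist x x₀ < s → dist (f x) (f x₀) < ε := by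
  have hS : IsCompact ((closure D' ×ˢ closure D') ∩ {q : Y × Y | ε ≤ dist q.1 q.2}) :=
    (hcomp.prod hcomp).inter_right (isClosed_le continuous_const continuous_dist)
  obtain ⟨R, hR, hRc⟩ := Metric.exists_isCompact_closedBall x₀
  suffices h : ∃ s > (0 : ℝ), ∀ f ∈ F, ∀ x, dist x x₀ < s →
      (f x, f x₀) ∉ (closure D' ×ˢ closure D') ∩ {q : Y × Y | ε ≤ dist q.1 q.2} by
    obtain ⟨s, hs, h⟩ := h
    refine ⟨s, hs, fun f hf x hx => ?_⟩
    by_contra! hcon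
    exact h f hf x hx ⟨⟨subset_closure (hFD f hf x), subset_closure (hFD f hf x₀)⟩, hcon⟩
  refine hS.induction_on (p := fun S => ∃ s > (0 : ℝ), ∀ f ∈ F, ∀ x, dist x x₀ < s →
      (f x, f x₀) ∉ S) ⟨1, one_pos, fun _ _ _ _ => notMem_empty _⟩ ?_ ?_ ?_
  · rintro S T hST ⟨s, hs, h⟩
    exact ⟨s, hs, fun f hf x hx hm => h f hf x hx (hST hm)⟩
  · rintro S T ⟨s, hs, h⟩ ⟨t, ht, h'⟩
    refine ⟨min s t, lt_min hs ht, fun f hf x hx hm => ?_⟩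
    rw [lt_min_iff] at hx
    exact hm.elim (h f hf x hx.1) (h' f hf x hx.2)
  rintro ⟨y₁, y₂⟩ ⟨⟨hy₁, hy₂⟩, hyε⟩
  have hne : y₁ ≠ y₂ := dist_pos.1 (hε.trans_le hyε)
  obtain ⟨K₁, K₂, hK₁, hK₂, hKd, hyK₁, hyK₂, hKD₁, hKD₂⟩ :=
    hA.exists_disjoint_continua hD' hb hy₁ hy₂ hne
  obtain ⟨O₁, O₂, hO₁, hO₂, hKO₁, hKO₂, hO⟩ :=
    SeparatedNhds.of_isCompact_isCompact hK₁.1 hK₂.1 hKd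
  obtain ⟨B₁, hBO₁, hB₁, U₁, hU₁, hβ₁⟩ := exists_continua_of_nhds hK₁ hO₁ hKO₁ hyK₁ hKD₁
  obtain ⟨B₂, hBO₂, hB₂, U₂, hU₂, hβ₂⟩ := exists_continua_of_nhds hK₂ hO₂ hKO₂ hyK₂ hKD₂
  have hBd : Disjoint B₁ B₂ := hO.mono hBO₁ hBO₂
  obtain ⟨d, hd, hdB⟩ := Metric.exists_pos_forall_lt_edist hB₁ hB₂.isClosed hBd
  have hd0 : (0 : ℝ) < d := by exact_mod_cast hd
  have hdist : ∀ b₁ ∈ B₁, ∀ b₂ ∈ B₂, (d : ℝ) < dist b₂ b₁ := fun b₁ h₁ b₂ h₂ => by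
    have := hdB b₁ h₁ b₂ h₂
    rw [edist_comm, edist_nndist] at this
    exact_mod_cast this
  -- The inverse Poletsky inequality works with rings about one centre, so paths between `B₁` and
  -- `B₂` are sorted by a finite cover of `B₁`. The total bound `M` is independent of `f`.
  obtain ⟨t, htB, hcover⟩ := hB₁.elim_nhds_subcover (fun y => Metric.ball y (d / 2))
    fun y _ => Metric.ball_mem_nhds y (by linarith)
  set M : ℝ≥0∞ := ∑ _i ∈ t, (∫⁻ w in D', Q w ∂ν) * ENNReal.ofReal (2 / d) ^ a' with hM
  have hMtop : M ≠ ∞ := by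
    rw [hM, ENNReal.sum_ne_top]
    exact fun _ _ => ENNReal.mul_ne_top hQ
      (ENNReal.rpow_ne_top_of_nonneg ha' ENNReal.ofReal_ne_top)
  obtain ⟨s, hs, hsM⟩ := hcap.exists_lt_modulus ha hL hMtop hR
  refine ⟨U₁ ×ˢ U₂, mem_nhdsWithin_of_mem_nhds (prod_mem_nhds hU₁ hU₂), min s R, lt_min hs hR,
    fun f hf x hx hm => ?_⟩
  rw [lt_min_iff] at hx
  have hreach : ∀ {B : Set Y} {z : X}, dist z x₀ < R →
      (∃ β ⊆ B, IsContinuum β ∧ f z ∈ β ∧ ¬ β ⊆ D') →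
      ∃ C, IsContinuum C ∧ z ∈ C ∧ (∀ w ∈ C, f w ∈ B) ∧ ∃ w ∈ C, R ≤ dist w x₀ := by
    rintro B z hz ⟨β, hβB, hβ, hzβ, hβD⟩
    rcases exists_continuum_or_subset_image f (hFo f hf) hRc (Metric.mem_ball.2 hz)
      hβ.1.isClosed hβ.2.isPreconnected hzβ with ⟨C, -, hC, hzC, hCβ, w, hw, hwR⟩ | hsub
    · exact ⟨C, hC, hzC, fun u hu => hβB (hCβ ⟨u, hu, rfl⟩), w, hw, hwR.ge⟩
    -- A continuum leaving `D'` cannot be covered by an image inside `D'`, so its lift reaches the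
    -- sphere.
    · exact absurd (hsub.trans (image_subset_iff.2 fun u _ => hFD f hf u)) hβD
  obtain ⟨C₁, hC₁, hxC₁, hCB₁, hCR₁⟩ := hreach hx.2 (hβ₁ _ hm.1)
  obtain ⟨C₂, hC₂, hxC₂, hCB₂, hCR₂⟩ := hreach (by rwa [dist_self]) (hβ₂ _ hm.2)
  have hCd : Disjoint C₁ C₂ := disjoint_left.2 fun z h₁ h₂ =>
    disjoint_left.1 hBd (hCB₁ z h₁) (hCB₂ z h₂)
  refine (hsM C₁ C₂ hC₁ hC₂ hCd ⟨x, hxC₁, hx.1⟩ hCR₁ ⟨x₀, hxC₂, by rwa [dist_self]⟩ hCR₂).not_ge ?_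
  have hsub : joining C₁ C₂ univ ⊆ ⋃ i ∈ t, {γ | γ ∈ joining C₁ C₂ univ ∧
      f (γ.toFun γ.left) ∈ Metric.ball i (d / 2)} := by
    intro γ hγ
    obtain ⟨i, hi, hγi⟩ := mem_iUnion₂.1 (hcover (hCB₁ _ hγ.1))
    exact mem_iUnion₂.2 ⟨i, hi, hγ, hγi⟩
  refine (modulus_mono hsub).trans ((modulus_biUnion_le ha _ _).trans
    (Finset.sum_le_sum fun i hi => ?_))
  refine le_trans ?_ ((hFP f hf i).modulus_le (hFD f hf) hd0
    ⟨x₀, hdist _ (htB i hi) _ (hCB₂ _ hxC₂)⟩)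
  refine modulus_le_ringFamily f i (by linarith) fun γ hγ => ?_
  exact ⟨γ.left, γ.right, le_rfl, γ.left_lt_right.le, le_rfl, (Metric.mem_ball.1 hγ.2).le,
    (hdist _ (htB i hi) _ (hCB₂ _ hγ.1.2.1)).le⟩

end Equicontinuity

/-! ### Large subcontinua with small images. -/

section Oscillation

variable {X Y : Type*} [MetricSpace X] [MetricSpace Y]

/-- For an equicontinuous family, the points of a continuum `E` lie in subcontinua of diameter
bounded below on which the mappings oscillate little. -/
theorem IsContinuum.exists_subcontinuum_of_equicontinuous {F : Set C(X, Y)} {ε : ℝ}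
    (hF : ∀ x₀ : X, ∃ s > (0 : ℝ), ∀ f ∈ F, ∀ x, dist x x₀ < s → dist (f x) (f x₀) < ε / 2)
    {E : Set X} (hE : IsContinuum E) : ∃ c > (0 : ℝ), ∀ f ∈ F, ∀ e ∈ E,
      (∃ e' ∈ E, ε ≤ dist (f e') (f e)) →
      ∃ P ⊆ E, IsContinuum P ∧ e ∈ P ∧ (∃ w ∈ P, c ≤ dist e w) ∧
        ∀ z ∈ P, dist (f z) (f e) < ε := by
  -- The membership is doubled so that the compactness induction varies only the first copy of `E`.
  suffices h : ∃ c > (0 : ℝ), ∀ f ∈ F, ∀ e ∈ E, e ∈ E →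
      (∃ e' ∈ E, ε ≤ dist (f e') (f e)) →
      ∃ P ⊆ E, IsContinuum P ∧ e ∈ P ∧ (∃ w ∈ P, c ≤ dist e w) ∧
        ∀ z ∈ P, dist (f z) (f e) < ε by
    obtain ⟨c, hc, h⟩ := h
    exact ⟨c, hc, fun f hf e he => h f hf e he he⟩
  refine hE.1.induction_on (p := fun S => ∃ c > (0 : ℝ), ∀ f ∈ F, ∀ e ∈ S, e ∈ E →
      (∃ e' ∈ E, ε ≤ dist (f e') (f e)) →
      ∃ P ⊆ E, IsContinuum P ∧ e ∈ P ∧ (∃ w ∈ P, c ≤ dist e w) ∧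
        ∀ z ∈ P, dist (f z) (f e) < ε) ⟨1, one_pos, by simp⟩ ?_ ?_ ?_
  · rintro S T hST ⟨c, hc, h⟩
    exact ⟨c, hc, fun f hf e he => h f hf e (hST he)⟩
  · rintro S T ⟨c, hc, h⟩ ⟨c', hc', h'⟩
    refine ⟨min c c', lt_min hc hc', fun f hf e he heE hex => ?_⟩
    rcases he with he | he
    · obtain ⟨P, h1, h2, h3, ⟨w, hw, hcw⟩, h4⟩ := h f hf e he heE hex
      exact ⟨P, h1, h2, h3, ⟨w, hw, (min_le_left _ _).trans hcw⟩, h4⟩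
    · obtain ⟨P, h1, h2, h3, ⟨w, hw, hcw⟩, h4⟩ := h' f hf e he heE hex
      exact ⟨P, h1, h2, h3, ⟨w, hw, (min_le_right _ _).trans hcw⟩, h4⟩
  intro x₀ _
  obtain ⟨s, hs, hsF⟩ := hF x₀
  refine ⟨Metric.ball x₀ (s / 2), mem_nhdsWithin_of_mem_nhds (Metric.ball_mem_nhds _ (by linarith)),
    s / 4, by linarith, fun f hf e he heE hex => ?_⟩
  rw [Metric.mem_ball] at he
  have hosc : ∀ z, dist z e ≤ s / 4 → dist (f z) (f e) < ε := fun z hz => by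
    have h1 := hsF f hf z (by linarith [dist_triangle z e x₀])
    have h2 := hsF f hf e (by linarith)
    linarith [dist_triangle_right (f z) (f e) (f x₀)]
  obtain ⟨e', he', hεe⟩ := hex
  have hfar : s / 4 ≤ dist e' e := by
    by_contra! hcon
    exact (hosc e' hcon.le).not_ge hεe
  obtain ⟨P, hP, hPc, heP, w, hw, hwr⟩ := hE.exists_subcontinuum heE (by linarith : 0 < s / 4)
    ⟨e', he', hfar⟩
  exact ⟨P, hP.trans inter_subset_left, hPc, heP, ⟨w, hw, by rw [dist_comm, hwr]⟩,
    fun z hz => hosc z (hP hz).2⟩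

theorem exists_le_dist_of_le_diam {X : Type*} {f : X → Y} {E : Set X} {δ r : ℝ}
    (hδ : δ ≤ Metric.diam (f '' E)) (hr : 0 ≤ r) (hrδ : 2 * r < δ) (y : Y) :
    ∃ e ∈ E, r ≤ dist (f e) y := by
  by_contra! hcon
  have hsub : f '' E ⊆ Metric.closedBall y r :=
    image_subset_iff.2 fun e he => Metric.mem_closedBall.2 (hcon e he).le
  have := Metric.diam_le_of_subset_closedBall hr hsub
  linarith

end Oscillation

theorem lintegral_ne_top_of_isCompact {Y : Type*} [MetricSpace Y] [MeasurableSpace Y]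
    {ν : Measure Y} {Q : Y → ℝ≥0∞} {K : Set Y} (hK : IsCompact K)
    (hQ : ∀ y ∈ K, ∃ r > (0 : ℝ), ∫⁻ z in Metric.ball y r, Q z ∂ν ≠ ∞) :
    ∫⁻ z in K, Q z ∂ν ≠ ∞ := by
  refine hK.induction_on (p := fun s => ∫⁻ z in s, Q z ∂ν ≠ ∞) (by simp)
    (fun s t hst h => ne_top_of_le_ne_top h (lintegral_mono_set hst))
    (fun s t hs ht => ne_top_of_le_ne_top (ENNReal.add_ne_top.2 ⟨hs, ht⟩)
      (lintegral_union_le _ _ _)) fun y hy => ?_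
  obtain ⟨r, hr, h⟩ := hQ y hy
  exact ⟨_, mem_nhdsWithin_of_mem_nhds (Metric.ball_mem_nhds y hr), h⟩

end MetricKoebe

/-! ### The Koebe-type theorem. -/

theorem theorem1p1 {X X' : Type*}
    [MetricSpace X] [MeasurableSpace X] [BorelSpace X]
    [MetricSpace X'] [MeasurableSpace X'] [BorelSpace X']
    (μ : Measure X) (hμ : ∀ (x : X) (r : ℝ), 0 < r →
      0 < μ (Metric.ball x r) ∧ μ (Metric.ball x r) < ∞)
    (μ' : Measure X') [IsLocallyFiniteMeasure μ']
    (α α' : ℝ) (hα : 2 ≤ α) (hα' : 2 ≤ α')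
    (D : Set X) (hD : MetricKoebe.IsMetricDomain D)
    (hDdim : dimH D = ENNReal.ofReal α)
    (hDconn : LocallyConnectedSpace D) (hDcomp : LocallyCompactSpace D)
    (hDLoewner : MetricKoebe.IsLoewnerSpace (μ.comap ((↑) : D → X)) α)
    (D' : Set X') (hD' : MetricKoebe.IsMetricDomain D')
    (hD'A : MetricKoebe.ConditionA D') (hD'bdry : (frontier D').Nontrivial)
    (hD'comp : IsCompact (closure D'))
    (hX'dim : dimH (univ : Set X') = ENNReal.ofReal α')
    (hX'path : LocallyPathConnectedSpace X') (hX'comp : LocallyCompactSpace X')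
    (hX'reg : MetricKoebe.UpperRegular μ' α') (hX'log : MetricKoebe.LogDoubling μ' α')
    (Q : X' → ℝ≥0∞) (hQ : AEMeasurable Q μ')
    (hQfmo : ∀ y ∈ closure D', MetricKoebe.HasFMOAt μ' Q y)
    (E : Set D) (hE : MetricKoebe.IsContinuum E) (δ : ℝ) (hδ : 0 < δ)
    (x₀ : D) (ε₁ : ℝ) (hε₁ : 0 < ε₁) (hball : Metric.ball (x₀ : X) ε₁ ⊆ D) :
    ∃ r₀ : ℝ, 0 < r₀ ∧ ∀ f ∈ MetricKoebe.koebeClass μ μ' α α' D D' Q E δ,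
      Metric.ball (f x₀) r₀ ⊆ f '' Metric.ball x₀ ε₁ := by

  have hα0 : 0 < α := by linarith
  set F := MetricKoebe.koebeClass μ μ' α α' D D' Q E δ with hF
  rcases F.eq_empty_or_nonempty with h0 | ⟨f₀, hf₀⟩
  · exact ⟨1, one_pos, fun f hf => absurd hf (h0 ▸ notMem_empty f)⟩
  have hring := fun (y : X') (hy : y ∈ closure D') (r₂ ε : ℝ) (hr₂ : 0 < r₂) (hε : 0 < ε) =>
    MetricKoebe.exists_modulus_ringFamily_le hα' hX'reg hX'log hQ (hQfmo y hy) hr₂ hε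
  have hcap : ∀ x : D, MetricKoebe.HasZeroCapacity (μ.comap ((↑) : D → X)) α x := fun x =>
    MetricKoebe.hasZeroCapacity_of_ringFamily hα0 f₀ x (hf₀.2.2.1 _) fun r₂ hr₂ ε hε => by
      obtain ⟨r₁, h1, h2, h3⟩ := hring (f₀ x) (subset_closure (hf₀.1 x)) r₂ ε hr₂ hε
      exact ⟨r₁, h1, h2, h3 _ _ f₀ (hf₀.2.2.2.1 _)⟩
  have hQD : ∫⁻ w in D', Q w ∂μ' ≠ ∞ :=
    ne_top_of_le_ne_top (MetricKoebe.lintegral_ne_top_of_isCompact hD'comp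
      fun y hy => (hQfmo y hy).1) (lintegral_mono_set subset_closure)
  have hequi := fun x : D => MetricKoebe.exists_forall_dist_lt hα0 (by linarith)
    (hDLoewner.2 8 (by norm_num)) hD' hD'A hD'bdry hD'comp hQD (F := F) (fun f hf => hf.1)
    -- Oscillation below `δ / 24` on `P` keeps `f(P)` outside `B(y₀, δ / 4)`, since `δ / 3 - δ / 24
    -- > δ / 4`.
    (fun f hf => hf.2.1) (fun f hf => hf.2.2.2.1) (hcap x) (ε := δ / 24 / 2) (by linarith)
  obtain ⟨c, hc, hsubE⟩ := hE.exists_subcontinuum_of_equicontinuous hequi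
  obtain ⟨R₁, hR₁, hR₁c⟩ := Metric.exists_isCompact_closedBall x₀
  obtain ⟨R, hR0, hR⟩ := exists_between (lt_min hR₁ hε₁)
  rw [lt_min_iff] at hR
  have hRc : IsCompact (Metric.closedBall x₀ R) := hR₁c.of_isClosed_subset
    Metric.isClosed_closedBall (Metric.closedBall_subset_closedBall hR.1.le)
  obtain ⟨T, hT, hET⟩ := hE.1.isBounded.subset_closedBall_lt 0 x₀
  have hm : 0 < min R c := lt_min hR0 hc
  -- `C` and `P` will have diameters at least `min R c` and distance at most `T`, so `ε` lies
  -- strictly below the modulus between them.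
  obtain ⟨ε, hε, hεL⟩ := ENNReal.lt_iff_exists_nnreal_btwn.1 (hDLoewner.2 _ (div_pos hT hm))
  have hε0 : (0 : ℝ) < ε := by exact_mod_cast hε
  suffices h : ∃ r₀ : ℝ, 0 < r₀ ∧ ∀ f ∈ F, f x₀ ∈ closure D' →
      Metric.ball (f x₀) r₀ ⊆ f '' Metric.ball x₀ ε₁ by
    obtain ⟨r₀, hr₀, h⟩ := h
    exact ⟨r₀, hr₀, fun f hf => h f hf (subset_closure (hf.1 x₀))⟩
  -- The ring radius depends on its centre, so a radius is found near each `y₀` and made uniform by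
  -- compactness.
  refine hD'comp.induction_on (p := fun S => ∃ r₀ : ℝ, 0 < r₀ ∧ ∀ f ∈ F, f x₀ ∈ S →
      Metric.ball (f x₀) r₀ ⊆ f '' Metric.ball x₀ ε₁) ⟨1, one_pos, by simp⟩ ?_ ?_ ?_
  · rintro S S' hS ⟨r, hr, h⟩
    exact ⟨r, hr, fun f hf hfx => h f hf (hS hfx)⟩
  · rintro S S' ⟨r, hr, h⟩ ⟨r', hr', h'⟩
    refine ⟨min r r', lt_min hr hr', fun f hf hfx => hfx.elim (fun hfx => ?_) fun hfx => ?_⟩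
    · exact (Metric.ball_subset_ball (min_le_left _ _)).trans (h f hf hfx)
    · exact (Metric.ball_subset_ball (min_le_right _ _)).trans (h' f hf hfx)
  intro y₀ hy₀
  obtain ⟨r₁, hr₁, hr₁₂, hmod⟩ := hring y₀ hy₀ (δ / 4) ε (by linarith) hε0
  obtain ⟨U, ⟨hU, hUp⟩, hUr⟩ :=
    (path_connected_basis y₀).mem_iff.1 (Metric.ball_mem_nhds y₀ hr₁)
  obtain ⟨r, hr, hrU⟩ := Metric.mem_nhds_iff.1 hU
  refine ⟨_, mem_nhdsWithin_of_mem_nhds (Metric.ball_mem_nhds y₀ (half_pos hr)), r / 2, half_pos hr,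
    fun f hf hfx y hy => ?_⟩
  have hxU : f x₀ ∈ U := hrU (Metric.ball_subset_ball (by linarith) hfx)
  have hyU : y ∈ U := hrU (by
    rw [Metric.mem_ball] at hy hfx ⊢
    linarith [dist_triangle y (f x₀) y₀])
  obtain ⟨γ, hγ⟩ := hUp.joinedIn (f x₀) hxU y hyU
  have hγc := MetricKoebe.isContinuum_range_path γ
  rcases MetricKoebe.exists_continuum_or_subset_image f hf.2.1 hRc (Metric.mem_ball_self hR0)
    hγc.1.isClosed hγc.2.isPreconnected ⟨0, γ.source⟩ with
      ⟨C, -, hC, hxC, hCγ, w, hw, hwR⟩ | hsub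
  · exfalso
    have hCy : ∀ z ∈ C, dist (f z) y₀ < r₁ := fun z hz => by
      obtain ⟨t, ht⟩ := hCγ ⟨z, hz, rfl⟩
      rw [← ht]
      exact hUr (hγ t)
    obtain ⟨e, he, hey⟩ := MetricKoebe.exists_le_dist_of_le_diam hf.2.2.2.2
      (by linarith : 0 ≤ δ / 3) (by linarith) y₀
    obtain ⟨P, hPE, hP, heP, ⟨v, hv, hcv⟩, hPf⟩ := hsubE f hf e he
      (MetricKoebe.exists_le_dist_of_le_diam hf.2.2.2.2 (by linarith) (by linarith) (f e))
    have hPy : ∀ z ∈ P, δ / 4 < dist (f z) y₀ := fun z hz => by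
      linarith [hPf z hz, dist_triangle_left (f e) y₀ (f z)]
    have hCP : Disjoint C P := disjoint_left.2 fun z h1 h2 => by
      linarith [hCy z h1, hPy z h2]
    have hlow := MetricKoebe.loewnerFunction_le_modulus (μ := μ.comap ((↑) : D → X)) (n := α)
      hC hP hCP hm hT.le hxC hw heP hv
      (by rw [dist_comm, hwR]; exact min_le_left _ _) ((min_le_right _ _).trans hcv)
      (by rw [dist_comm]; exact hET he)
    have hup : MetricKoebe.modulus (μ.comap ((↑) : D → X)) α (MetricKoebe.joining C P univ) ≤ ε := by
      refine le_trans ?_ ((hmod _ α f (hf.2.2.2.1 y₀) ⟨e, hPy e heP⟩).trans (by simp))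
      refine MetricKoebe.modulus_le_ringFamily f y₀ hr₁₂ fun γ hγ => ?_
      exact ⟨γ.left, γ.right, le_rfl, γ.left_lt_right.le, le_rfl, (hCy _ hγ.1).le,
        (hPy _ hγ.2.1).le⟩
    exact (hεL.trans_le (hlow.trans hup)).false
  · exact image_mono (Metric.ball_subset_ball hR.2.le) (hsub ⟨1, γ.target⟩)
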